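/- Let $\rho$ be an invertible density matrix on $n_v$ qubits. Let $H_1,\dots,H_N$ be matrices on $n_v+n_h$ qubits ($n_v$ visible, $n_h$ hidden), each Hermitian and unitary, let $\theta\in\mathbb R^N$, let $$\sigma_v(\theta)=\mathrm{Tr}_h\Big[e^{-iH_1\theta_1}\cdots e^{-iH_N\theta_N}\,|0\rangle\langle 0|\,e^{iH_N\theta_N}\cdots e^{iH_1\theta_1}\Big]$$ be the output of the unitary quantum neural network on the visible qubits, and let $\widetilde D_2(\sigma\|\rho)=\log \mathrm{Tr}(\sigma^2\rho^{-1})$. Consider quantum circuits that start in $|0\cdots0\rangle$, consist of arbitrary single-qubit gates, Toffoli gates, reflections $I-2|0\cdots0\rangle\langle0\cdots0|$ on sets of qubits, and oracle queries, and end with a measurement of all qubits in the computational basis, from whose outcome a real number $\mathcal E$ is computed classically. The oracles, each of which may be queried with or without one control qubit, are: a unitary $\mathcal O_{\rho^{-1}}$ on $n_v+n_a$ qubits with $\mathrm{Tr}_{\rm anc}\big(\mathcal O_{\rho^{-1}}|0\rangle\langle0|\mathcal O_{\rho^{-1}}^\dagger\big)=\rho^{-1}/\mathrm{Tr}(\rho^{-1})$,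 and its inverse; $\mathcal O_H:|j\rangle|\psi\rangle\mapsto|j\rangle H_j|\psi\rangle$; and, for every real $t$, $\mathcal O_{\exp}(t):|j\rangle|\psi\rangle\mapsto|j\rangle e^{-iH_jt}|\psi\rangle$, where the index $j$ is written in binary. There is a universal constant $C>0$ such that for all $n_v,n_h,n_a,N$, all $k\in\{1,\dots,N\}$, $\theta\in\mathbb R^N$, $\varepsilon>0$ and $p>0$ there are a circuit and a classical post-processing rule, which do not depend on $\rho$, on the $H_j$ or on the oracles, such that: (a) the number of single-qubit gates, Toffoli gates and queries in the circuit is at most $C\,\dfrac{N+n_v}{\varepsilon\,p}$; (b) the number of reflections in the circuit is at most $\dfrac{C}{\varepsilon\,p}$, and the numbers of qubits on which they act add up to at most $C\,\dfrac{N+n_v+n_h+n_a}{\varepsilon\,p}$; (c) for all $\rho$, $H_1,\dots,H_N$ and $\mathcal O_{\rho^{-1}}$ as above with $p\le \mathrm{Tr}\big(\sigma_v^2\rho^{-1}/\mathrm{Tr}(\rho^{-1})\big)$ and $\varepsilon\le \dfrac{13}{2\,\mathrm{Tr}(\sigma_v^2\rho^{-1})}$, the derivative $\partial_{\theta_k}\widetilde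 D_2(\sigma_v\|\rho)$ exists, and with probability greater than $2/3$ $$\big|\mathcal E-\partial_{\theta_k}\widetilde D_2(\sigma_v\|\rho)\big|\le\varepsilon .$$ In particular, for $p=\mathrm{Tr}\big(\sigma_v^2\rho^{-1}/\mathrm{Tr}(\rho^{-1})\big)$ the number of gates and queries is $O\!\left(\dfrac{N+n_v}{\varepsilon\,\mathrm{Tr}(\sigma_v^2\rho^{-1}/\mathrm{Tr}(\rho^{-1}))}\right)$. -/

import Mathlib

open Matrix
open scoped ComplexOrder

noncomputable section

namespace QNN

/-! ### Qubits, partial trace, the unitary network and the divergence -/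

/-- Computational basis states of a register whose qubits are labelled by `R`. -/
abbrev Bits (R : Type) : Type := R → Bool

/-- Square complex matrices on the register `R`. -/
abbrev Op (R : Type) : Type := Matrix (Bits R) (Bits R) ℂ

/-- The projector `|0…0⟩⟨0…0|`. -/
def zeroProj (R : Type) [Fintype R] [DecidableEq R] : Op R :=
  Matrix.single (fun _ => false) (fun _ => false) 1

/-- Partial trace over the second of two registers. -/
def partialTrace {R S : Type} [Fintype S] [DecidableEq S] (A : Op (R ⊕ S)) : Op R :=
  Matrix.of fun x y => ∑ z : Bits S, A (Sum.elim x z) (Sum.elim y z)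

/-- `e^{-iHt}`. -/
def evolution {R : Type} [Fintype R] [DecidableEq R] (H : Op R) (t : ℝ) : Op R :=
  NormedSpace.exp ((-(Complex.I * (t : ℂ))) • H)

/-- The unitary of the network, `e^{-iH_1θ_1} e^{-iH_2θ_2} ⋯ e^{-iH_Nθ_N}` in this order. -/
def network {R : Type} [Fintype R] [DecidableEq R] {N : ℕ} (H : Fin N → Op R)
    (θ : Fin N → ℝ) : Op R :=
  (List.ofFn fun j => evolution (H j) (θ j)).prod

/-- The state of the network on all its qubits. -/
def outputState {R : Type} [Fintype R] [DecidableEq R] {N : ℕ} (H : Fin N → Op R)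
    (θ : Fin N → ℝ) : Op R :=
  network H θ * zeroProj R * (network H θ)ᴴ

/-- The output `σ_v` on the visible qubits. -/
def visibleState {nv nh N : ℕ} (H : Fin N → Op (Fin nv ⊕ Fin nh)) (θ : Fin N → ℝ) :
    Op (Fin nv) :=
  partialTrace (outputState H θ)

/-- `D̃₂(σ‖ρ) = log Tr(σ² ρ⁻¹)`. -/
def maxRenyi2 {R : Type} [Fintype R] [DecidableEq R] (σ ρ : Op R) : ℝ :=
  Real.log (σ ^ 2 * ρ⁻¹).trace.re

/-- `ρ⁻¹ / Tr(ρ⁻¹)`. -/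
def normalizedInverse {R : Type} [Fintype R] [DecidableEq R] (ρ : Op R) : Op R :=
  (ρ⁻¹.trace)⁻¹ • ρ⁻¹

/-- `ρ` is a density matrix with an inverse. -/
def IsInvertibleState {R : Type} [Fintype R] [DecidableEq R] (ρ : Op R) : Prop :=
  ρ.PosDef ∧ ρ.trace = 1

/-- The unitary `W` prepares, from `|0⟩|0⟩`, a purification of `ρ⁻¹ / Tr(ρ⁻¹)` whose
purifying register has `a` qubits. -/
def PreparesInverse {nv a : ℕ} (W : Op (Fin nv ⊕ Fin a)) (ρ : Op (Fin nv)) : Prop :=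
  W ∈ Matrix.unitaryGroup (Bits (Fin nv ⊕ Fin a)) ℂ ∧
    partialTrace (W * zeroProj (Fin nv ⊕ Fin a) * Wᴴ) = normalizedInverse ρ

/-! ### Circuits with oracle gates -/

/-- Number of qubits of the register that holds the index of a Hamiltonian term. -/
abbrev indexSize (N : ℕ) : ℕ := Nat.clog 2 N

/-- The operator `|j⟩|ψ⟩ ↦ |j⟩ V_j |ψ⟩`, the index being written in binary; binary strings that
are not an index act trivially. -/
def selectOp {R : Type} [Fintype R] [DecidableEq R] {N : ℕ} (V : Fin N → Op R) :
    Op (Fin (indexSize N) ⊕ R) :=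
  Matrix.of fun x y =>
    if x ∘ Sum.inl = y ∘ Sum.inl then
      (if h : Nat.ofBits (x ∘ Sum.inl) < N then V ⟨Nat.ofBits (x ∘ Sum.inl), h⟩ else 1)
        (x ∘ Sum.inr) (y ∘ Sum.inr)
    else 0

/-- A gate of a circuit on `n` qubits. The oracle queries may carry one control qubit. A circuit
is syntax: it refers to the oracles by name only. -/
inductive Gate (nv nh a N n : ℕ) : Type
  /-- an arbitrary unitary on one qubit -/
  | single (q : Fin n) (U : Matrix Bool Bool ℂ) (hU : U ∈ Matrix.unitaryGroup Bool ℂ)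
  /-- a Toffoli gate with controls `c₁`, `c₂` and target `t` -/
  | toffoli (c₁ c₂ t : Fin n) (h₁₂ : c₁ ≠ c₂) (h₁ : c₁ ≠ t) (h₂ : c₂ ≠ t)
  /-- the reflection `I - 2 |0…0⟩⟨0…0|` on the qubits in `S` -/
  | reflection (S : Finset (Fin n))
  /-- a query to the preparation oracle of `ρ⁻¹ / Tr(ρ⁻¹)`, or to its inverse -/
  | queryPrep (inverse : Bool) (ctrl : Option (Fin n)) (e : Fin nv ⊕ Fin a ↪ Fin n)
      (hc : ∀ c ∈ ctrl, c ∉ Set.range e)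
  /-- a query to `|j⟩|ψ⟩ ↦ |j⟩ H_j |ψ⟩` -/
  | queryHam (ctrl : Option (Fin n)) (e : Fin (indexSize N) ⊕ (Fin nv ⊕ Fin nh) ↪ Fin n)
      (hc : ∀ c ∈ ctrl, c ∉ Set.range e)
  /-- a query to `|j⟩|ψ⟩ ↦ |j⟩ e^{-iH_j t} |ψ⟩` -/
  | queryExp (t : ℝ) (ctrl : Option (Fin n))
      (e : Fin (indexSize N) ⊕ (Fin nv ⊕ Fin nh) ↪ Fin n)
      (hc : ∀ c ∈ ctrl, c ∉ Set.range e)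

/-- State vectors on `n` qubits. -/
abbrev Ket (n : ℕ) : Type := Bits (Fin n) → ℂ

/-- The operator `U` applied to the register embedded by `e`. -/
def applyOn {R : Type} [Fintype R] [DecidableEq R] {n : ℕ} (e : R ↪ Fin n) (U : Op R)
    (ψ : Ket n) : Ket n :=
  fun x => ∑ y : Bits R, U (x ∘ e) y * ψ (Function.extend e y x)

/-- The same with an optional control qubit. -/
def applyCtrl {R : Type} [Fintype R] [DecidableEq R] {n : ℕ} (ctrl : Option (Fin n))
    (e : R ↪ Fin n) (U : Op R) (ψ : Ket n) : Ket n :=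
  match ctrl with
  | none => applyOn e U ψ
  | some c => fun x => if x c = true then applyOn e U ψ x else ψ x

/-- The action of a gate on a state vector, for the given oracles. -/
def Gate.act {nv nh a N n : ℕ} (W : Op (Fin nv ⊕ Fin a)) (H : Fin N → Op (Fin nv ⊕ Fin nh)) :
    Gate nv nh a N n → Ket n → Ket n
  | .single q U _, ψ => fun x => ∑ b : Bool, U (x q) b * ψ (Function.update x q b)
  | .toffoli c₁ c₂ t _ _ _, ψ =>
      fun x => ψ (if x c₁ && x c₂ then Function.update x t (!(x t)) else x)
  | .reflection S, ψ => fun x => if ∀ q ∈ S, x q = false then -ψ x else ψ x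
  | .queryPrep inverse ctrl e _, ψ => applyCtrl ctrl e (if inverse then Wᴴ else W) ψ
  | .queryHam ctrl e _, ψ => applyCtrl ctrl e (selectOp H) ψ
  | .queryExp t ctrl e _, ψ => applyCtrl ctrl e (selectOp fun j => evolution (H j) t) ψ

/-- Circuits: the head of the list acts first. -/
abbrev Circuit (nv nh a N n : ℕ) : Type := List (Gate nv nh a N n)

/-- The final state of a circuit started in `|0…0⟩`. -/
def Circuit.run {nv nh a N n : ℕ} (c : Circuit nv nh a N n) (W : Op (Fin nv ⊕ Fin a))
    (H : Fin N → Op (Fin nv ⊕ Fin nh)) : Ket n :=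
  c.foldl (fun ψ g => g.act W H ψ) (Pi.single (fun _ => false) 1)

/-- The probability that measuring all qubits at the end of the circuit gives an outcome in
`E`. -/
def Circuit.prob {nv nh a N n : ℕ} (c : Circuit nv nh a N n) (W : Op (Fin nv ⊕ Fin a))
    (H : Fin N → Op (Fin nv ⊕ Fin nh)) (E : Set (Bits (Fin n))) : ℝ :=
  open Classical in ∑ x : Bits (Fin n), if x ∈ E then ‖c.run W H x‖ ^ 2 else 0

/-- The cost of a gate: single-qubit gates, Toffoli gates and queries count one each. The
reflections are counted separately, by the two functions below. -/
def Gate.cost {nv nh a N n : ℕ} : Gate nv nh a N n → ℕ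
  | .reflection _ => 0
  | _ => 1

/-- One for a reflection, zero for every other gate. -/
def Gate.reflections {nv nh a N n : ℕ} : Gate nv nh a N n → ℕ
  | .reflection _ => 1
  | _ => 0

/-- The number of qubits on which a reflection acts, zero for every other gate. -/
def Gate.reflectionSize {nv nh a N n : ℕ} : Gate nv nh a N n → ℕ
  | .reflection S => S.card
  | _ => 0

/-- Number of single-qubit gates, Toffoli gates and queries in a circuit. -/
def Circuit.cost {nv nh a N n : ℕ} (c : Circuit nv nh a N n) : ℕ :=
  (c.map Gate.cost).sum

/-- Number of reflections `I - 2 |0…0⟩⟨0…0|` in a circuit. -/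
def Circuit.reflections {nv nh a N n : ℕ} (c : Circuit nv nh a N n) : ℕ :=
  (c.map Gate.reflections).sum

/-- Total number of qubits on which the reflections of a circuit act. -/
def Circuit.reflectionSize {nv nh a N n : ℕ} (c : Circuit nv nh a N n) : ℕ :=
  (c.map Gate.reflectionSize).sum

end QNN

end

noncomputable section

/-! Write B(θ) = Tr(σ_v(θ)² P) with P = ρ⁻¹/Tr(ρ⁻¹). Since Tr(ρ⁻¹) does not depend on θ, the
derivative of the divergence is A/B with A = ∂B/∂θ_k. Each H_j is an involution, so σ_v is a
combination of 1, cos 2θ_k and sin 2θ_k, and B is a trigonometric polynomial with frequencies 2 and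
4 in θ_k. Hence A is a fixed combination of the values of B at the shifts ±π/4 and ±π/8
(`hasDerivAt_traceForm`), and it suffices to estimate five values of B.

Each √B is an amplitude. Apply W, then the network V on the visible and hidden qubits, then V† with
the visible half of the purification in place of the visible qubits. The component with zeros on the
register of V† is σ_v applied to the purification, of squared norm B (`zeroProb_prepOp`). The swap
is a choice of labels and costs nothing.

Amplitude estimation is done by Hadamard tests of the powers G^(4^j), j ≤ J, of the Grover iterate
on one copy of the state. The tests apply polynomials in G, and G rotates the prepared state in a
plane by an angle ±y with |cos(y/2)| = √B. The outcomes are therefore an equal mixture of two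
families of independent bits, one for y and one for −y (`norm_sq_aeval`, `amplitudeCircuit_prob`).
Repeating level j about 2^(J−j) times keeps the total failure probability below 1/16 with O(4^J)
Grover iterates and no logarithmic factor, and any phase compatible with all levels gives √B up to
4^(−J) (`Consistent.abs_cos_half`).

Two devices keep a Grover iterate at O(N) gates: only its two reflections are controlled, the oracle
queries cancelling when these are idle, and the binary index of a query is wired to qubits that are
constantly 0 or 1, so no gates are needed to write it.

Finally, an error δ in √B is an error of order √B δ in B, and Cauchy-Schwarz gives |A| ≤ 4√B. The
error of the quotient is thus O(δ/B), so δ of order εp suffices and the cost is O(N/(εp)). The five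
estimations run on disjoint qubits, with joint success probability at least (15/16)⁵ > 2/3. -/

namespace QNN

/-! ### Polynomials in an isometry acting on an invariant plane -/

open Polynomial in
/-- If `ψ` is a unit vector which an isometry `G` rotates by the angle `y` inside a plane, then
the squared norm of `f(G)ψ` is the average of `|f|²` over the two eigenvalues `e^{±iy}`. -/
theorem norm_sq_aeval {ι : Type*} [Fintype ι] (G : Module.End ℂ (ι → ℂ)) (ψ : ι → ℂ) (y : ℝ)
    (hG : ∀ v, star (G v) ⬝ᵥ G v = star v ⬝ᵥ v)
    (hψ : star ψ ⬝ᵥ ψ = 1) (hc : star ψ ⬝ᵥ G ψ = (Real.cos y : ℂ))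
    (hr : G (G ψ) = (2 * Real.cos y : ℂ) • G ψ - ψ) (f : ℂ[X]) :
    ∑ i, ‖aeval G f ψ i‖ ^ 2 =
      (‖f.eval (Complex.exp (y * Complex.I))‖ ^ 2
        + ‖f.eval (Complex.exp ((-y : ℝ) * Complex.I))‖ ^ 2) / 2 := by
  -- This polynomial kills ψ and has the roots e^{±iy}, so only the remainder aX + b of f matters.
  -- No eigenvectors are needed, which includes the degenerate case sin y = 0.
  set q : ℂ[X] := X ^ 2 - C (2 * Real.cos y : ℂ) * X + C 1 with hq
  have hdeg : q.natDegree = 2 := by rw [hq]; compute_degree!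
  have hmon : q.Monic := by rw [hq]; monicity!
  have hqψ : aeval G q ψ = 0 := by
    simp only [hq, map_add, map_sub, map_mul, aeval_X, aeval_C, LinearMap.add_apply,
      LinearMap.sub_apply, pow_two, Module.End.mul_apply, hr, Module.algebraMap_end_apply]
    ext i
    simp
    ring
  have hz : ∀ s : ℝ, Real.cos s = Real.cos y →
      q.eval (Complex.exp (s * Complex.I)) = 0 := by
    intro s hs
    have h1 : Complex.exp (s * Complex.I) = Complex.cos s + Complex.sin s * Complex.I :=
      Complex.exp_mul_I _
    have h2 : (Complex.cos s : ℂ) = Real.cos y := by rw [← hs]; simp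
    have h3 := Complex.sin_sq_add_cos_sq (s : ℂ)
    simp only [hq, eval_add, eval_sub, eval_pow, eval_X, eval_mul, eval_C, h1, ← h2]
    linear_combination (Complex.sin s) ^ 2 * Complex.I_sq - h3
  set r := f %ₘ q with hrdef
  have hf : f = q * (f /ₘ q) + r := by rw [add_comm]; exact (modByMonic_add_div f q).symm
  have hrdeg : r.natDegree ≤ 1 := by
    have h1 : q ≠ 1 := by intro h; rw [h] at hdeg; simp at hdeg
    have := natDegree_modByMonic_lt f hmon h1
    rw [hdeg] at this
    exact Nat.le_of_lt_succ this
  obtain ⟨a, b, hab⟩ : ∃ a b, r = C a * X + C b := exists_eq_X_add_C_of_natDegree_le_one hrdeg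
  have hfψ : aeval G f ψ = a • G ψ + b • ψ := by
    rw [hf, map_add, LinearMap.add_apply, mul_comm, map_mul, Module.End.mul_apply, hqψ, hab]
    simp [Module.algebraMap_end_apply]
  have he : ∀ s : ℝ, Real.cos s = Real.cos y → f.eval (Complex.exp (s * Complex.I)) =
      a * Complex.exp (s * Complex.I) + b := by
    intro s hs
    rw [hf, eval_add, eval_mul, hz s hs, hab]; simp
  have hsum : ∀ v : ι → ℂ, ((∑ i, ‖v i‖ ^ 2 : ℝ) : ℂ) = star v ⬝ᵥ v := by
    intro v
    simp only [dotProduct, Pi.star_apply]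
    push_cast
    exact Finset.sum_congr rfl fun i _ => (Complex.conj_mul' _).symm
  have hc' : star (G ψ) ⬝ᵥ ψ = (Real.cos y : ℂ) := by
    rw [← star_star (star (G ψ) ⬝ᵥ ψ), ← star_dotProduct_star, star_star, hc]
    simp [← Complex.cos_conj]
  rw [he y rfl, he (-y) (Real.cos_neg y), hfψ]
  have hnorm : ∀ s : ℝ, ((‖a * Complex.exp (s * Complex.I) + b‖ ^ 2 : ℝ) : ℂ) =
      star a * a + star b * b + star b * a * Complex.exp (s * Complex.I)
        + star a * b * Complex.exp (-s * Complex.I) := by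
    intro s
    push_cast
    rw [← Complex.conj_mul']
    have h4 : (starRingEnd ℂ) (Complex.exp (s * Complex.I)) = Complex.exp (-s * Complex.I) := by
      rw [← Complex.exp_conj]; simp
    have h5 : Complex.exp (-s * Complex.I) * Complex.exp (s * Complex.I) = 1 := by
      rw [← Complex.exp_add]; simp
    rw [map_add, map_mul, h4]
    simp only [starRingEnd_apply]
    linear_combination (star a * a) * h5
  have h2c : Complex.exp (y * Complex.I) + Complex.exp (-y * Complex.I) = 2 * Real.cos y := by
    rw [Complex.exp_mul_I, Complex.exp_mul_I]; simp; ring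
  apply Complex.ofReal_injective
  rw [hsum, Complex.ofReal_div, Complex.ofReal_add, hnorm, hnorm]
  simp only [star_add, star_smul, add_dotProduct, dotProduct_add, smul_dotProduct,
    dotProduct_smul, hG, hψ, hc, hc', smul_eq_mul]
  push_cast
  rw [neg_neg]
  push_cast at h2c
  linear_combination (-(star b * a + star a * b) / 2) * h2c

/-! ### Operators on a register and reflections about zero strings -/

theorem extend_comp_emb {R L X : Type} (e : R ↪ L) (y : R → X) (x : L → X) :
    Function.extend e y x ∘ e = y :=
  Function.extend_comp e.injective y x

theorem extend_extend {R L X : Type} (e : R ↪ L) (y y' : R → X) (x : L → X) :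
    Function.extend e y (Function.extend e y' x) = Function.extend e y x := by
  ext l
  by_cases h : ∃ r, e r = l
  · obtain ⟨r, rfl⟩ := h
    simp [e.injective.extend_apply]
  · simp [Function.extend_apply' _ _ _ h]

theorem extend_comp_self {R L X : Type} (e : R ↪ L) (x : L → X) :
    Function.extend e (x ∘ e) x = x := by
  ext l
  by_cases h : ∃ r, e r = l
  · obtain ⟨r, rfl⟩ := h
    simp [e.injective.extend_apply]
  · simp [Function.extend_apply' _ _ _ h]

/-- The operator `U` applied to the register embedded by `e`. -/
def onReg {R L : Type} [Fintype R] [DecidableEq R] (e : R ↪ L) (U : Op R) :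
    Module.End ℂ (Bits L → ℂ) where
  toFun ψ x := ∑ y : Bits R, U (x ∘ e) y * ψ (Function.extend e y x)
  map_add' φ ψ := by ext x; simp [mul_add, Finset.sum_add_distrib]
  map_smul' c ψ := by
    ext x; simp only [Pi.smul_apply, smul_eq_mul, RingHom.id_apply, Finset.mul_sum]
    exact Finset.sum_congr rfl fun y _ => by ring

section Reg

variable {R L : Type} [Fintype R] [DecidableEq R]

theorem onReg_apply (e : R ↪ L) (U : Op R) (ψ : Bits L → ℂ) (x : Bits L) :
    onReg e U ψ x = ∑ y : Bits R, U (x ∘ e) y * ψ (Function.extend e y x) := rfl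

theorem onReg_one (e : R ↪ L) : onReg e (1 : Op R) = 1 := by
  ext1 ψ
  ext x
  simp only [onReg_apply, Module.End.one_apply, Matrix.one_apply, ite_mul, one_mul, zero_mul,
    Finset.sum_ite_eq, Finset.mem_univ, if_true, extend_comp_self]

theorem onReg_mul (e : R ↪ L) (U V : Op R) : onReg e (U * V) = onReg e U * onReg e V := by
  ext1 ψ
  ext x
  simp only [onReg_apply, Module.End.mul_apply, Matrix.mul_apply, extend_extend, extend_comp_emb,
    Finset.sum_mul, Finset.mul_sum]
  rw [Finset.sum_comm]
  simp only [mul_assoc]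

theorem onReg_adjoint [Fintype L] [DecidableEq L] (e : R ↪ L) (U : Op R) (φ ψ : Bits L → ℂ) :
    star (onReg e U φ) ⬝ᵥ ψ = star φ ⬝ᵥ onReg e Uᴴ ψ := by
  simp only [dotProduct, onReg_apply, Pi.star_apply, star_sum, Finset.sum_mul, Finset.mul_sum,
    ← Fintype.sum_prod_type']
  -- This involution exchanges the content of the register with the summation variable and so
  -- matches the two double sums.
  refine Finset.sum_nbij' (fun p => (Function.extend e p.2 p.1, p.1 ∘ e))
    (fun p => (Function.extend e p.2 p.1, p.1 ∘ e)) ?_ ?_ ?_ ?_ ?_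
  · simp
  · simp
  · rintro ⟨x, y⟩ -
    simp [extend_extend, extend_comp_emb, extend_comp_self]
  · rintro ⟨x, y⟩ -
    simp [extend_extend, extend_comp_emb, extend_comp_self]
  · rintro ⟨x, y⟩ -
    simp only [extend_extend, extend_comp_emb, extend_comp_self, conjTranspose_apply, star_mul']
    ring

/-- The reflection `1 - 2 |0…0⟩⟨0…0|` on the qubits in `S`. -/
def reflect (S : Finset L) : Module.End ℂ (Bits L → ℂ) where
  toFun ψ x := if ∀ q ∈ S, x q = false then -ψ x else ψ x
  map_add' φ ψ := by ext x; simp only [Pi.add_apply]; split_ifs <;> ring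
  map_smul' c ψ := by
    ext x; simp only [Pi.smul_apply, smul_eq_mul, RingHom.id_apply]; split_ifs <;> ring

theorem reflect_apply (S : Finset L) (ψ : Bits L → ℂ) (x : Bits L) :
    reflect S ψ x = if ∀ q ∈ S, x q = false then -ψ x else ψ x := rfl

theorem reflect_mul_self (S : Finset L) : reflect S * reflect S = 1 := by
  ext1 ψ
  ext x
  simp only [Module.End.mul_apply, reflect_apply, Module.End.one_apply]
  split_ifs <;> simp

theorem reflect_adjoint [Fintype L] [DecidableEq L] (S : Finset L) (φ ψ : Bits L → ℂ) :
    star (reflect S φ) ⬝ᵥ ψ = star φ ⬝ᵥ reflect S ψ := by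
  simp only [dotProduct, reflect_apply, Pi.star_apply]
  refine Finset.sum_congr rfl fun x _ => ?_
  split_ifs <;> simp

theorem reflect_univ [Fintype L] [DecidableEq L] (ψ : Bits L → ℂ) :
    reflect Finset.univ ψ =
      ψ - (2 * ψ (fun _ => false)) • (Pi.single (fun _ => false) 1 : Bits L → ℂ) := by
  ext x
  simp only [reflect_apply, Finset.mem_univ, forall_true_left, Pi.sub_apply, Pi.smul_apply,
    smul_eq_mul]
  by_cases h : ∀ q, x q = false
  · have : x = fun _ => false := funext h
    subst this
    simp; ring
  · have : x ≠ fun _ => false := fun h' => h fun q => congrFun h' q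
    simp [h, this]

end Reg

/-! ### The Grover iterate as a rotation -/

/-- The Grover iterate `A R₀ A⁻¹ R_S`, where `R₀` reflects on all qubits. -/
def grover {L : Type} [Fintype L] (A A' : Module.End ℂ (Bits L → ℂ)) (S : Finset L) :
    Module.End ℂ (Bits L → ℂ) :=
  A * reflect Finset.univ * A' * reflect S

section Grover

variable {L : Type} [Fintype L] [DecidableEq L] {A A' : Module.End ℂ (Bits L → ℂ)}

/-- `A * reflect univ * A'` is the reflection 1 − 2|ψ⟩⟨ψ| with ψ = A|0…0⟩. In this rank-one form the
rotation of the plane becomes plain algebra. -/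
theorem grover_apply (hAA : A * A' = 1) (hadj : ∀ φ ψ, star (A φ) ⬝ᵥ ψ = star φ ⬝ᵥ A' ψ)
    (S : Finset L) (v : Bits L → ℂ) :
    grover A A' S v = reflect S v
      - (2 * (star (A (Pi.single (fun _ => false) 1)) ⬝ᵥ reflect S v)) •
        A (Pi.single (fun _ => false) 1) := by
  have h : ∀ w, A (A' w) = w := fun w => by
    rw [← Module.End.mul_apply, hAA, Module.End.one_apply]
  simp only [grover, Module.End.mul_apply, reflect_univ, map_sub, map_smul, h, hadj]
  congr 3
  simp [dotProduct, Pi.single_apply]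

theorem grover_isometry (hAA : A' * A = 1) (hAA' : A * A' = 1)
    (hadj : ∀ φ ψ, star (A φ) ⬝ᵥ ψ = star φ ⬝ᵥ A' ψ) (S : Finset L) (v : Bits L → ℂ) :
    star (grover A A' S v) ⬝ᵥ grover A A' S v = star v ⬝ᵥ v := by
  have hA : ∀ w, A' (A w) = w := fun w => by
    rw [← Module.End.mul_apply, hAA, Module.End.one_apply]
  have hA' : ∀ w, A (A' w) = w := fun w => by
    rw [← Module.End.mul_apply, hAA', Module.End.one_apply]
  have hR : ∀ (S : Finset L) w, reflect S (reflect S w) = w := fun S w => by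
    rw [← Module.End.mul_apply, reflect_mul_self, Module.End.one_apply]
  have h1 : ∀ (S : Finset L) w, star (reflect S w) ⬝ᵥ reflect S w = star w ⬝ᵥ w := fun S w => by
    rw [reflect_adjoint, hR]
  have h2 : ∀ w, star (A w) ⬝ᵥ A w = star w ⬝ᵥ w := fun w => by rw [hadj, hA]
  have h3 : ∀ w, star (A' w) ⬝ᵥ A' w = star w ⬝ᵥ w := fun w => by
    rw [← h2 (A' w), hA']
  simp only [grover, Module.End.mul_apply, h1, h2, h3]

/-- The squared norm of the part of `ψ` in which all qubits in `S` are `0`. -/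
def zeroProb (S : Finset L) (ψ : Bits L → ℂ) : ℝ :=
  ∑ x : Bits L, if ∀ q ∈ S, x q = false then ‖ψ x‖ ^ 2 else 0

theorem dotProduct_reflect (S : Finset L) (ψ : Bits L → ℂ) (hψ : star ψ ⬝ᵥ ψ = 1) :
    star ψ ⬝ᵥ reflect S ψ = ((1 - 2 * zeroProb S ψ : ℝ) : ℂ) := by
  have h1 : ∀ x, star (ψ x) * ψ x = ((‖ψ x‖ ^ 2 : ℝ) : ℂ) := fun x => by
    push_cast; exact Complex.conj_mul' _
  push_cast
  rw [← hψ, zeroProb]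
  simp only [dotProduct, reflect_apply, Pi.star_apply]
  push_cast
  rw [Finset.mul_sum, ← Finset.sum_sub_distrib]
  refine Finset.sum_congr rfl fun x _ => ?_
  split_ifs
  · rw [mul_neg, h1]; push_cast; ring
  · simp

theorem zeroProb_nonneg (S : Finset L) (ψ : Bits L → ℂ) : 0 ≤ zeroProb S ψ :=
  Finset.sum_nonneg fun x _ => by split_ifs <;> positivity

theorem zeroProb_le_one (S : Finset L) (ψ : Bits L → ℂ) (hψ : star ψ ⬝ᵥ ψ = 1) :
    zeroProb S ψ ≤ 1 := by
  have h1 : ∑ x, ‖ψ x‖ ^ 2 = 1 := by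
    apply Complex.ofReal_injective
    rw [Complex.ofReal_one, ← hψ]
    push_cast
    exact Finset.sum_congr rfl fun x _ => (Complex.conj_mul' _).symm
  rw [← h1]
  refine Finset.sum_le_sum fun x _ => ?_
  split_ifs
  · exact le_rfl
  · positivity

open Polynomial in
/-- The Grover iterate rotates `A|0…0⟩` by an angle `y` with `cos y = 2P - 1`, where `P` is the
probability of finding the qubits in `S` in `0`. -/
theorem norm_sq_aeval_grover (hAA : A' * A = 1) (hAA' : A * A' = 1)
    (hadj : ∀ φ ψ, star (A φ) ⬝ᵥ ψ = star φ ⬝ᵥ A' ψ) (S : Finset L) (y : ℝ)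
    (hy : Real.cos y = 2 * zeroProb S (A (Pi.single (fun _ => false) 1)) - 1) (f : ℂ[X]) :
    ∑ i, ‖aeval (grover A A' S) f (A (Pi.single (fun _ => false) 1)) i‖ ^ 2 =
      (‖f.eval (Complex.exp (y * Complex.I))‖ ^ 2
        + ‖f.eval (Complex.exp ((-y : ℝ) * Complex.I))‖ ^ 2) / 2 := by
  have hA : ∀ w, A' (A w) = w := fun w => by
    rw [← Module.End.mul_apply, hAA, Module.End.one_apply]
  have hR : ∀ w, reflect S (reflect S w) = w := fun w => by
    rw [← Module.End.mul_apply, reflect_mul_self, Module.End.one_apply]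
  have hψ : star (A (Pi.single (fun _ => false) 1)) ⬝ᵥ A (Pi.single (fun _ => false) 1) = 1 := by
    rw [hadj, hA]; simp [dotProduct, Pi.single_apply]
  have hG := grover_apply hAA' hadj S
  set ψ := A (Pi.single (fun _ => false) 1) with hψdef
  -- The iterate carries no global minus sign, so ⟨ψ, R_S ψ⟩ = 1 − 2P is −cos y, and the amplitude
  -- is a cosine of y/2 and not a sine.
  have hd : star ψ ⬝ᵥ reflect S ψ = -(Real.cos y : ℂ) := by
    rw [dotProduct_reflect S ψ hψ, hy]; push_cast; ring
  have hGψ : grover A A' S ψ = reflect S ψ + (2 * Real.cos y : ℂ) • ψ := by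
    rw [hG, hd, mul_neg, neg_smul, sub_neg_eq_add]
  refine norm_sq_aeval _ ψ y (grover_isometry hAA hAA' hadj S) hψ ?_ ?_ f
  · rw [hGψ, dotProduct_add, dotProduct_smul, hψ, hd, smul_eq_mul]; ring
  · rw [hG (grover A A' S ψ), hGψ, map_add, map_smul, hR, dotProduct_add, dotProduct_smul, hψ, hd]
    ext i
    simp only [Pi.sub_apply, Pi.add_apply, Pi.smul_apply, smul_eq_mul]
    ring

end Grover

/-! ### Independent signs and Chebyshev's inequality -/

/-- The value `±1` of a measured bit. -/
def bitSign (b : Bool) : ℝ := if b then -1 else 1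

section Statistics

variable {τ : Type} [Fintype τ]

/-- The probability of the outcome `y` for independent bits whose signs have means `μ t`. -/
def bitWeight (μ : τ → ℝ) (y : τ → Bool) : ℝ := ∏ t, (1 + bitSign (y t) * μ t) / 2

theorem bitWeight_nonneg {μ : τ → ℝ} (hμ : ∀ t, |μ t| ≤ 1) (y : τ → Bool) :
    0 ≤ bitWeight μ y := by
  refine Finset.prod_nonneg fun t _ => ?_
  have := abs_le.1 (hμ t)
  cases y t <;> simp [bitSign] <;> linarith

variable [DecidableEq τ]

/-- Independence: the expectation of a product over the bits is the product of the expectations.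
Normalisation and covariances are special cases. -/
theorem sum_bitWeight_mul (μ : τ → ℝ) (g : τ → Bool → ℝ) :
    ∑ y, bitWeight μ y * ∏ t, g t (y t) =
      ∏ t, ((1 + μ t) / 2 * g t false + (1 - μ t) / 2 * g t true) := by
  have h := Finset.prod_univ_sum (fun _ : τ => (Finset.univ : Finset Bool))
    (fun t b => (1 + bitSign b * μ t) / 2 * g t b)
  rw [Fintype.piFinset_univ] at h
  simp only [Fintype.sum_bool, bitSign, if_true] at h
  simp only [bitWeight, ← Finset.prod_mul_distrib, bitSign]
  rw [← h]
  refine Finset.prod_congr rfl fun t _ => ?_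
  simp only [Bool.false_eq_true, if_false]
  ring

theorem sum_bitWeight (μ : τ → ℝ) : ∑ y, bitWeight μ y = 1 := by
  have h := sum_bitWeight_mul μ (fun _ _ => 1)
  simp only [Finset.prod_const_one, mul_one] at h
  rw [h]
  exact Finset.prod_eq_one fun t _ => by ring

/-- Cross terms vanish by independence, and the variance of a sign of mean μ is 1 − μ² ≤ 1. -/
theorem sum_bitWeight_deviation_mul (μ : τ → ℝ) (s t : τ) :
    ∑ y, bitWeight μ y * ((bitSign (y s) - μ s) * (bitSign (y t) - μ t)) ≤
      if s = t then 1 else 0 := by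
  have h := sum_bitWeight_mul μ (fun u b =>
    (if u = s then bitSign b - μ u else 1) * (if u = t then bitSign b - μ u else 1))
  simp only [Finset.prod_mul_distrib, Finset.prod_ite_eq', Finset.mem_univ, if_true] at h
  rw [h]
  split_ifs with hst
  · subst hst
    refine (Finset.prod_eq_single s ?_ ?_).trans_le ?_
    · intro u _ hu; simp only [hu, if_false]; ring
    · simp
    · simp only [if_true, bitSign, Bool.false_eq_true, if_false]
      nlinarith [sq_nonneg (μ s)]
  · refine (Finset.prod_eq_zero (Finset.mem_univ s) ?_).le
    simp only [if_true, hst, if_false, bitSign, Bool.false_eq_true]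
    ring

theorem sum_bitWeight_deviation_sq (μ : τ → ℝ) (T : Finset τ) :
    ∑ y, bitWeight μ y * (∑ t ∈ T, (bitSign (y t) - μ t)) ^ 2 ≤ T.card := by
  calc _ = ∑ s ∈ T, ∑ t ∈ T,
        ∑ y, bitWeight μ y * ((bitSign (y s) - μ s) * (bitSign (y t) - μ t)) := by
        rw [Finset.sum_congr rfl fun y _ => by rw [pow_two, Finset.sum_mul_sum, Finset.mul_sum],
          Finset.sum_comm]
        refine Finset.sum_congr rfl fun s _ => ?_
        rw [Finset.sum_congr rfl fun y _ => by rw [Finset.mul_sum], Finset.sum_comm]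
    _ ≤ ∑ s ∈ T, ∑ t ∈ T, if s = t then 1 else 0 :=
        Finset.sum_le_sum fun s _ => Finset.sum_le_sum fun t _ =>
          sum_bitWeight_deviation_mul μ s t
    _ = T.card := by simp

/-- Chebyshev's inequality with a union bound. -/
theorem sum_bitWeight_good {β : Type} [Fintype β] {μ : τ → ℝ} (hμ : ∀ t, |μ t| ≤ 1)
    (T : β → Finset τ) (hT : ∀ b, (T b).Nonempty) :
    1 - ∑ b, 16 / ((T b).card : ℝ) ≤ ∑ y, bitWeight μ y *
      (open Classical in
        if ∀ b, |∑ t ∈ T b, (bitSign (y t) - μ t)| ≤ (T b).card / 4 then 1 else 0) := by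
  classical
  -- Markov's inequality pointwise: a violated block makes its own normalised square at least 1, so
  -- the right-hand indicator dominates 1 minus the sum of these squares.
  have h1 : ∀ y : τ → Bool, (1 : ℝ) - ∑ b, 16 / ((T b).card : ℝ) ^ 2 *
      (∑ t ∈ T b, (bitSign (y t) - μ t)) ^ 2 ≤
      if ∀ b, |∑ t ∈ T b, (bitSign (y t) - μ t)| ≤ (T b).card / 4 then 1 else 0 := by
    intro y
    have hnn : ∀ b ∈ Finset.univ, 0 ≤ 16 / ((T b).card : ℝ) ^ 2 *
        (∑ t ∈ T b, (bitSign (y t) - μ t)) ^ 2 := fun b _ => by positivity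
    split_ifs with h
    · linarith [Finset.sum_nonneg hnn]
    · push Not at h
      obtain ⟨b, hb⟩ := h
      have hpos : 0 < ((T b).card : ℝ) := by exact_mod_cast (hT b).card_pos
      have hsq : ((T b).card / 4 : ℝ) ^ 2 ≤ (∑ t ∈ T b, (bitSign (y t) - μ t)) ^ 2 := by
        rw [← sq_abs (∑ t ∈ T b, _)]
        gcongr
      have : (1 : ℝ) ≤ 16 / ((T b).card : ℝ) ^ 2 * (∑ t ∈ T b, (bitSign (y t) - μ t)) ^ 2 := by
        rw [div_mul_eq_mul_div, le_div_iff₀ (by positivity)]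
        linarith
      linarith [Finset.single_le_sum hnn (Finset.mem_univ b)]
  calc 1 - ∑ b, 16 / ((T b).card : ℝ)
      ≤ 1 - ∑ b, 16 / ((T b).card : ℝ) ^ 2 *
          ∑ y, bitWeight μ y * (∑ t ∈ T b, (bitSign (y t) - μ t)) ^ 2 := by
        gcongr with b _
        have hpos : 0 < ((T b).card : ℝ) := by exact_mod_cast (hT b).card_pos
        calc _ ≤ 16 / ((T b).card : ℝ) ^ 2 * (T b).card := by
              gcongr; exact sum_bitWeight_deviation_sq μ _
          _ = _ := by field_simp
    _ = ∑ y, bitWeight μ y * (1 - ∑ b, 16 / ((T b).card : ℝ) ^ 2 *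
          (∑ t ∈ T b, (bitSign (y t) - μ t)) ^ 2) := by
        simp only [mul_sub, Finset.sum_sub_distrib, mul_one, sum_bitWeight, Finset.mul_sum]
        congr 1
        rw [Finset.sum_comm]
        exact Finset.sum_congr rfl fun y _ => Finset.sum_congr rfl fun b _ => by ring
    _ ≤ _ := by
        gcongr with y _
        · exact bitWeight_nonneg hμ y
        · exact h1 y

end Statistics

/-! ### Statistics of phase estimation at the scales 4^j -/

/-- The Hadamard tests of the phase estimation: at each level `j ≤ J`, repeated tests for the
cosine and the sine of `4^j` times the phase. -/
abbrev Test (J : ℕ) : Type := Σ j : Fin (J + 1), Bool × Fin (1024 * 2 ^ (J - j.1))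

/-- The mean of the sign of the outcome of a test, if the phase is `y`. -/
def testMean {J : ℕ} (y : ℝ) (t : Test J) : ℝ :=
  if t.2.1 then Real.sin (4 ^ t.1.1 * y) else Real.cos (4 ^ t.1.1 * y)

theorem abs_testMean_le {J : ℕ} (y : ℝ) (t : Test J) : |testMean y t| ≤ 1 := by
  unfold testMean
  split_ifs
  · exact Real.abs_sin_le_one _
  · exact Real.abs_cos_le_one _

/-- The tests of the same level and kind. -/
def testBlock {J : ℕ} (b : Fin (J + 1) × Bool) : Finset (Test J) :=
  Finset.univ.map ⟨fun i => ⟨b.1, b.2, i⟩, fun i i' h => by simpa using h⟩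

theorem card_testBlock {J : ℕ} (b : Fin (J + 1) × Bool) :
    (testBlock b).card = 1024 * 2 ^ (J - b.1.1) := by
  simp [testBlock]

/-- All empirical means deviate by at most `1/4` from the means for the phase `y`. -/
def Consistent {J : ℕ} (y : ℝ) (x : Test J → Bool) : Prop :=
  ∀ b : Fin (J + 1) × Bool, |∑ t ∈ testBlock b, (bitSign (x t) - testMean y t)| ≤
    (testBlock b).card / 4

theorem sum_two_pow_inv_le (J : ℕ) : ∑ j : Fin (J + 1), 1 / (2 : ℝ) ^ (J - j.1) ≤ 2 := by
  rw [Fin.sum_univ_eq_sum_range (fun j => 1 / (2 : ℝ) ^ (J - j)) (J + 1),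
    ← Finset.sum_range_reflect]
  calc ∑ j ∈ Finset.range (J + 1), 1 / (2 : ℝ) ^ (J - (J + 1 - 1 - j))
      = ∑ j ∈ Finset.range (J + 1), (1 / 2 : ℝ) ^ j := by
        refine Finset.sum_congr rfl fun j hj => ?_
        rw [Finset.mem_range] at hj
        rw [show J - (J + 1 - 1 - j) = j by omega]
        simp
    _ ≤ 2 := sum_geometric_two_le _

/-- Two blocks per level contribute 2 · 16/1024 = 1/32 times 2^(−(J−j)), and the geometric sum is at
most 2. Repeating the cheap low levels more often makes the union bound independent of J. -/
theorem sum_card_testBlock (J : ℕ) :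
    ∑ b : Fin (J + 1) × Bool, 16 / ((testBlock b).card : ℝ) ≤ 1 / 16 := by
  have h := sum_two_pow_inv_le J
  have : ∑ b : Fin (J + 1) × Bool, 16 / ((testBlock b).card : ℝ) =
      1 / 32 * ∑ j : Fin (J + 1), 1 / (2 : ℝ) ^ (J - j.1) := by
    rw [Finset.mul_sum, Fintype.sum_prod_type]
    refine Finset.sum_congr rfl fun j _ => ?_
    rw [Fintype.sum_bool, card_testBlock, card_testBlock]
    push_cast
    field_simp
    norm_num
  rw [this]
  linarith

theorem testBlock_nonempty {J : ℕ} (b : Fin (J + 1) × Bool) : (testBlock b).Nonempty := by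
  rw [← Finset.card_pos, card_testBlock]
  positivity

theorem consistent_prob {J : ℕ} (y : ℝ) :
    15 / 16 ≤ ∑ x : Test J → Bool, bitWeight (testMean y) x *
      (open Classical in if Consistent y x then 1 else 0) := by
  have hgood := sum_bitWeight_good (abs_testMean_le (J := J) y) testBlock testBlock_nonempty
  have := sum_card_testBlock J
  refine (show (15 : ℝ) / 16 ≤ 1 - _ by linarith).trans (hgood.trans (le_of_eq ?_))
  refine Finset.sum_congr rfl fun x _ => ?_
  by_cases h : Consistent y x
  · rw [if_pos h, if_pos (by exact h)]
  · rw [if_neg h, if_neg (by exact h)]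

/-- Both means lie within 1/4 of the same empirical mean, because all tests of a block have the same
mean. -/
theorem Consistent.abs_sub_le {J : ℕ} {y y' : ℝ} {x : Test J → Bool} (h : Consistent y x)
    (h' : Consistent y' x) (t : Test J) : |testMean y t - testMean y' t| ≤ 1 / 2 := by
  have hb := h (t.1, t.2.1)
  have hb' := h' (t.1, t.2.1)
  have hc := card_testBlock (J := J) (t.1, t.2.1)
  have hpos : (0 : ℝ) < (testBlock (J := J) (t.1, t.2.1)).card := by rw [hc]; positivity
  have hm : ∀ z, ∑ s ∈ testBlock (t.1, t.2.1), (bitSign (x s) - testMean z s) =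
      ∑ s ∈ testBlock (t.1, t.2.1), bitSign (x s)
        - (testBlock (J := J) (t.1, t.2.1)).card * testMean z t := by
    intro z
    rw [Finset.sum_sub_distrib]
    congr 1
    rw [← nsmul_eq_mul, ← Finset.sum_const]
    refine Finset.sum_congr rfl fun s hs => ?_
    simp only [testBlock, Finset.mem_map, Finset.mem_univ, true_and] at hs
    obtain ⟨i, rfl⟩ := hs
    rfl
  rw [hm] at hb hb'
  rw [abs_le] at *
  constructor <;> nlinarith

/-- The threshold 3/4 exceeds cos(π/4) = √2/2, and the cosine decreases on [0, π]. -/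
theorem abs_le_of_cos {x : ℝ} (hx : |x| ≤ Real.pi) (hc : 3 / 4 ≤ Real.cos x) :
    |x| ≤ Real.pi / 4 := by
  by_contra! h
  have := Real.cos_lt_cos_of_nonneg_of_le_pi (by positivity) hx h
  rw [Real.cos_abs, Real.cos_pi_div_four] at this
  have h2 : √2 < 3 / 2 := by
    rw [Real.sqrt_lt' (by norm_num)]; norm_num
  linarith

/-- The difference φ of two consistent phases, taken modulo 2π, satisfies cos(4^j φ) ≥ 3/4 at every
level. Starting from |φ| ≤ π, each level divides the bound on |φ| by four. Any consistent phase is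
therefore as good as the true one. -/
theorem Consistent.abs_cos_half {J : ℕ} {y y' : ℝ} {x : Test J → Bool} (h : Consistent y x)
    (h' : Consistent y' x) :
    |(|Real.cos (y / 2)| - |Real.cos (y' / 2)|)| ≤ 1 / 4 ^ J := by
  obtain ⟨k, hk, -⟩ := existsUnique_sub_zsmul_mem_Ioc Real.two_pi_pos (y - y') (-Real.pi)
  simp only [zsmul_eq_mul] at hk
  set φ := y - y' - k * (2 * Real.pi) with hφ
  have hφπ : |φ| ≤ Real.pi := abs_le.2 ⟨hk.1.le, by linarith [hk.2]⟩
  have hcos : ∀ j ≤ J, 3 / 4 ≤ Real.cos (4 ^ j * φ) := by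
    intro j hj
    -- The reduction modulo 2π is harmless since 4^j is an integer.
    have e : 4 ^ j * φ = 4 ^ j * y - 4 ^ j * y' - ((4 ^ j * k : ℤ) : ℝ) * (2 * Real.pi) := by
      rw [hφ]; push_cast; ring
    rw [e, Real.cos_sub_int_mul_two_pi, Real.cos_sub]
    have hs := h.abs_sub_le h' ⟨⟨j, by omega⟩, true, ⟨0, by positivity⟩⟩
    have hc := h.abs_sub_le h' ⟨⟨j, by omega⟩, false, ⟨0, by positivity⟩⟩
    simp only [testMean, if_true, Bool.false_eq_true, if_false] at hs hc
    have hs2 := sq_le_sq' (abs_le.1 hs).1 (abs_le.1 hs).2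
    have hc2 := sq_le_sq' (abs_le.1 hc).1 (abs_le.1 hc).2
    -- cos(u − v) = 1 − ((cos u − cos v)² + (sin u − sin v)²)/2 ≥ 1 − (1/4 + 1/4)/2.
    nlinarith [Real.sin_sq_add_cos_sq (4 ^ j * y), Real.sin_sq_add_cos_sq (4 ^ j * y')]
  have hsmall : ∀ j ≤ J, |4 ^ j * φ| ≤ Real.pi / 4 := by
    intro j
    induction j with
    | zero => intro _; exact abs_le_of_cos (by simpa using hφπ) (hcos 0 (Nat.zero_le _))
    | succ j ih =>
      intro hj
      refine abs_le_of_cos ?_ (hcos _ hj)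
      -- The bound π/4 becomes exactly π after multiplication by 4, which excludes the other
      -- branches of the cosine at the next level.
      have := ih (by omega)
      rw [pow_succ, mul_right_comm, abs_mul]
      rw [abs_of_pos (by norm_num : (0 : ℝ) < 4)]
      linarith
  have hfin := hsmall J le_rfl
  rw [abs_mul, abs_of_pos (by positivity : (0 : ℝ) < 4 ^ J)] at hfin
  have hφle : |φ| ≤ 1 / 4 ^ J := by
    rw [le_div_iff₀ (by positivity)]
    linarith [Real.pi_le_four]
  have hy : |Real.cos (y / 2)| = |Real.cos (y' / 2 + φ / 2)| := by
    have : y / 2 = y' / 2 + φ / 2 + k * Real.pi := by rw [hφ]; ring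
    rw [this, Real.cos_add_int_mul_pi, abs_mul]
    simp
  rw [hy]
  calc _ ≤ |Real.cos (y' / 2 + φ / 2) - Real.cos (y' / 2)| := abs_abs_sub_abs_le_abs_sub _ _
    _ ≤ |y' / 2 + φ / 2 - y' / 2| := Real.abs_cos_sub_cos_le _ _
    _ = |φ| / 2 := by rw [add_sub_cancel_left, abs_div]; norm_num
    _ ≤ |φ| := by linarith [abs_nonneg φ]
    _ ≤ _ := hφle

/-- An estimate of `|cos (y/2)|` from the outcomes of the tests. -/
def estimateAmplitude {J : ℕ} (x : Test J → Bool) : ℝ :=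
  open Classical in if h : ∃ y, Consistent y x then |Real.cos (h.choose / 2)| else 0

theorem Consistent.estimate {J : ℕ} {y : ℝ} {x : Test J → Bool} (h : Consistent y x) :
    |estimateAmplitude x - (|Real.cos (y / 2)|)| ≤ 1 / 4 ^ J := by
  have hex : ∃ y, Consistent y x := ⟨y, h⟩
  rw [estimateAmplitude, dif_pos hex]
  exact hex.choose_spec.abs_cos_half h

theorem estimateAmplitude_prob {J : ℕ} (y r : ℝ) (hr : |Real.cos (y / 2)| = r) :
    15 / 16 ≤ ∑ x : Test J → Bool, bitWeight (testMean y) x *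
      (open Classical in if |estimateAmplitude x - r| ≤ 1 / 4 ^ J then 1 else 0) := by
  subst hr
  have hc := consistent_prob (J := J) y
  refine hc.trans ?_
  gcongr with x _
  · exact bitWeight_nonneg (abs_testMean_le y) x
  · by_cases h : Consistent y x
    · rw [if_pos h, if_pos h.estimate]
    · simp only [h, if_false]
      split_ifs <;> norm_num

/-! ### Circuits on arbitrary initial states -/

/-- The action of a circuit on an arbitrary initial state. -/
def Circuit.act {nv nh a N n : ℕ} (c : Circuit nv nh a N n) (W : Op (Fin nv ⊕ Fin a))
    (H : Fin N → Op (Fin nv ⊕ Fin nh)) (ψ : Ket n) : Ket n :=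
  c.foldl (fun ψ g => g.act W H ψ) ψ

section Act

variable {nv nh a N n : ℕ} (W : Op (Fin nv ⊕ Fin a)) (H : Fin N → Op (Fin nv ⊕ Fin nh))

theorem Circuit.run_eq (c : Circuit nv nh a N n) :
    c.run W H = Circuit.act c W H (Pi.single (fun _ => false) 1) := rfl

theorem Circuit.act_nil (ψ : Ket n) : Circuit.act ([] : Circuit nv nh a N n) W H ψ = ψ := rfl

theorem Circuit.act_cons (g : Gate nv nh a N n) (c : Circuit nv nh a N n) (ψ : Ket n) :
    Circuit.act (g :: c) W H ψ = Circuit.act c W H (g.act W H ψ) := rfl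

theorem Circuit.act_append (c d : Circuit nv nh a N n) (ψ : Ket n) :
    Circuit.act (c ++ d) W H ψ = Circuit.act d W H (Circuit.act c W H ψ) :=
  List.foldl_append

theorem Circuit.cost_append (c d : Circuit nv nh a N n) :
    Circuit.cost (c ++ d) = Circuit.cost c + Circuit.cost d := by
  simp [Circuit.cost]

theorem Circuit.reflections_append (c d : Circuit nv nh a N n) :
    Circuit.reflections (c ++ d) = Circuit.reflections c + Circuit.reflections d := by
  simp [Circuit.reflections]

theorem Circuit.reflectionSize_append (c d : Circuit nv nh a N n) :
    Circuit.reflectionSize (c ++ d) = Circuit.reflectionSize c + Circuit.reflectionSize d := by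
  simp [Circuit.reflectionSize]

end Act

/-! ### States with constant index qubits -/

section Encode

variable {Wk I τ : Type} {n : ℕ} (q : Wk ⊕ (I ⊕ I) ⊕ τ ≃ Fin n)

/-- The two families of index qubits are constantly `0` and constantly `1`. -/
def IndexReady (x : Bits (Fin n)) : Prop :=
  ∀ i, x (q (Sum.inr (Sum.inl i))) = Sum.elim (fun _ => false) (fun _ => true) i

/-- The state with amplitude `Φ y w` on the basis state whose working qubits are `w`, whose test
qubits are `y`, and whose two families of index qubits are constantly `0` and constantly `1`. -/
def encode (Φ : Bits τ → Bits Wk → ℂ) : Ket n :=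
  open Classical in fun x =>
    if IndexReady q x then
      Φ (fun t => x (q (Sum.inr (Sum.inr t)))) (fun w => x (q (Sum.inl w))) else 0

variable {q} in
theorem encode_of_ready {x : Bits (Fin n)} (h : IndexReady q x) (Φ : Bits τ → Bits Wk → ℂ) :
    encode q Φ x = Φ (fun t => x (q (Sum.inr (Sum.inr t)))) (fun w => x (q (Sum.inl w))) :=
  if_pos h

variable {q} in
theorem encode_of_not_ready {x : Bits (Fin n)} (h : ¬IndexReady q x)
    (Φ : Bits τ → Bits Wk → ℂ) : encode q Φ x = 0 :=
  if_neg h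

/-- The embedding of a register of working qubits. -/
def workEmb {R : Type} (r : R ↪ Wk) : R ↪ Fin n :=
  (r.trans Function.Embedding.inl).trans q.toEmbedding

theorem extend_workEmb_inl {R : Type} (r : R ↪ Wk) (y : Bits R) (x : Bits (Fin n)) (w : Wk) :
    Function.extend (workEmb q r) y x (q (Sum.inl w)) =
      Function.extend r y (fun w => x (q (Sum.inl w))) w := by
  by_cases h : ∃ i, r i = w
  · obtain ⟨i, rfl⟩ := h
    rw [r.injective.extend_apply]
    exact (workEmb q r).injective.extend_apply y x i
  · rw [Function.extend_apply' _ _ _ h, Function.extend_apply']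
    simpa [workEmb] using h

theorem extend_workEmb_inr {R : Type} (r : R ↪ Wk) (y : Bits R) (x : Bits (Fin n))
    (s : (I ⊕ I) ⊕ τ) :
    Function.extend (workEmb q r) y x (q (Sum.inr s)) = x (q (Sum.inr s)) := by
  rw [Function.extend_apply']
  simp [workEmb]

theorem applyOn_workEmb {R : Type} [Fintype R] [DecidableEq R] (r : R ↪ Wk) (U : Op R)
    (Φ : Bits τ → Bits Wk → ℂ) :
    applyOn (workEmb q r) U (encode q Φ) = encode q (fun y => onReg r U (Φ y)) := by
  ext x
  have h1 : ∀ y, (fun w => Function.extend (workEmb q r) y x (q (Sum.inl w))) =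
      Function.extend r y (fun w => x (q (Sum.inl w))) := fun y =>
    funext fun w => extend_workEmb_inl q r y x w
  have h2 : ∀ y, IndexReady q (Function.extend (workEmb q r) y x) ↔ IndexReady q x := fun y => by
    simp only [IndexReady, extend_workEmb_inr]
  by_cases h : IndexReady q x
  · rw [encode_of_ready h, onReg_apply]
    refine Finset.sum_congr rfl fun y _ => ?_
    rw [encode_of_ready ((h2 y).2 h), h1]
    simp only [extend_workEmb_inr]
    rfl
  · rw [encode_of_not_ready h]
    refine Finset.sum_eq_zero fun y _ => ?_
    rw [encode_of_not_ready (fun h' => h ((h2 y).1 h')), mul_zero]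

/-- The embedding of an index register, whose qubits are taken from the constant index qubits
according to the bits `b`, and of a register of working qubits. -/
def indexEmb {R : Type} (b : I → Bool) (r : R ↪ Wk) : I ⊕ R ↪ Fin n where
  toFun := Sum.elim
    (fun i => q (Sum.inr (Sum.inl (if b i then Sum.inr i else Sum.inl i)))) (workEmb q r)
  inj' := by
    rintro (i | i) (j | j) h
    · simp only [Sum.elim_inl, EmbeddingLike.apply_eq_iff_eq, Sum.inr.injEq, Sum.inl.injEq] at h
      split_ifs at h <;> simp_all
    · simp [workEmb] at h
    · simp [workEmb] at h
    · simpa using h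

/-- The select operator is block diagonal in the index basis, so at the basis state `x` only the
block named by the index bits of `x` enters. -/
theorem selectOp_apply {R : Type} [Fintype R] [DecidableEq R] {N : ℕ} (V : Fin N → Op R)
    (e : Fin (indexSize N) ⊕ R ↪ Fin n) (ψ : Ket n) (x : Bits (Fin n)) :
    applyOn e (selectOp V) ψ x =
      applyOn (Function.Embedding.inr.trans e)
        (if h : Nat.ofBits (x ∘ e ∘ Sum.inl) < N then V ⟨Nat.ofBits (x ∘ e ∘ Sum.inl), h⟩ else 1)
        ψ x := by
  have hext : ∀ v : Bits R, Function.extend e (Sum.elim (x ∘ e ∘ Sum.inl) v) x =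
      Function.extend (Function.Embedding.inr.trans e) v x := by
    intro v
    ext l
    by_cases h : ∃ s, e s = l
    · obtain ⟨s, rfl⟩ := h
      rw [e.injective.extend_apply]
      rcases s with i | i
      · rw [Function.extend_apply']
        · rfl
        · simp
      · exact ((Function.Embedding.inr.trans e).injective.extend_apply v x i).symm
    · rw [Function.extend_apply' _ _ _ h, Function.extend_apply']
      rintro ⟨i, hi⟩
      exact h ⟨_, hi⟩
  unfold applyOn
  rw [← (Equiv.sumArrowEquivProdArrow (Fin (indexSize N)) R Bool).symm.sum_comp,
    Fintype.sum_prod_type, Finset.sum_eq_single (x ∘ e ∘ Sum.inl)]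
  · refine Finset.sum_congr rfl fun v _ => ?_
    simp only [Equiv.sumArrowEquivProdArrow, Equiv.coe_fn_symm_mk, hext]
    congr 1
    simp only [selectOp, Matrix.of_apply, Sum.elim_comp_inl, Sum.elim_comp_inr, Function.comp_assoc,
      if_true]
    rfl
  · intro u _ hu
    refine Finset.sum_eq_zero fun v _ => ?_
    simp only [Equiv.sumArrowEquivProdArrow, Equiv.coe_fn_symm_mk, selectOp, Matrix.of_apply,
      Sum.elim_comp_inl, Function.comp_assoc]
    rw [if_neg (fun h => hu h.symm), zero_mul]
  · simp

end Encode

section Index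

variable {Wk τ : Type} {n N : ℕ} (q : Wk ⊕ (Fin (indexSize N) ⊕ Fin (indexSize N)) ⊕ τ ≃ Fin n)

/-- The digits of `j` are supplied by wiring: each index qubit of the query is taken from the family
of zeros or from the family of ones. A query thus costs one gate, without a factor log N for writing
the index. -/
theorem applyOn_indexEmb {R : Type} [Fintype R] [DecidableEq R] (r : R ↪ Wk) (V : Fin N → Op R)
    (j : Fin N) (Φ : Bits τ → Bits Wk → ℂ) :
    applyOn (indexEmb q (fun i => j.1.testBit i) r) (selectOp V) (encode q Φ) =
      encode q (fun y => onReg r (V j) (Φ y)) := by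
  ext x
  rw [selectOp_apply]
  have he : Function.Embedding.inr.trans (indexEmb q (fun i => j.1.testBit i) r) =
      workEmb q r := by
    ext i; rfl
  rw [he]
  by_cases hx : IndexReady q x
  · have hb : x ∘ (indexEmb q (fun i => j.1.testBit i) r) ∘ Sum.inl =
        fun i : Fin (indexSize N) => j.1.testBit i := by
      ext i
      have hi : (x ∘ (indexEmb q (fun i => j.1.testBit i) r) ∘ Sum.inl) i =
        x (q (Sum.inr (Sum.inl (if j.1.testBit i then Sum.inr i else Sum.inl i)))) := rfl
      rw [hi, hx]
      cases j.1.testBit i <;> simp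
    have hval : Nat.ofBits (x ∘ (indexEmb q (fun i => j.1.testBit i) r) ∘ Sum.inl) = j.1 := by
      rw [hb, Nat.ofBits_testBit]
      -- `Nat.ofBits_testBit` gives `j` modulo 2^(clog N), which is `j` because j < N ≤ 2^(clog N).
      exact Nat.mod_eq_of_lt (j.2.trans_le (Nat.le_pow_clog one_lt_two N))
    have hlt := hval.trans_lt j.2
    rw [dif_pos hlt, applyOn_workEmb]
    have : (⟨_, hlt⟩ : Fin N) = j := Fin.ext hval
    rw [this]
  · rw [applyOn_workEmb, encode_of_not_ready hx, encode_of_not_ready hx]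

end Index

section Single

variable {Wk I τ : Type} {n : ℕ} (q : Wk ⊕ (I ⊕ I) ⊕ τ ≃ Fin n)
variable {nv nh a N : ℕ} (W : Op (Fin nv ⊕ Fin a)) (H : Fin N → Op (Fin nv ⊕ Fin nh))

theorem act_single_test [DecidableEq τ] (t : τ) (U : Matrix Bool Bool ℂ)
    (hU : U ∈ Matrix.unitaryGroup Bool ℂ) (Φ : Bits τ → Bits Wk → ℂ) :
    (Gate.single (q (Sum.inr (Sum.inr t))) U hU : Gate nv nh a N n).act W H (encode q Φ) =
      encode q (fun y w => ∑ b : Bool, U (y t) b * Φ (Function.update y t b) w) := by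
  ext x
  have hw : ∀ b w, Function.update x (q (Sum.inr (Sum.inr t))) b (q (Sum.inl w)) =
      x (q (Sum.inl w)) := fun b w => Function.update_of_ne (by simp) _ _
  have hi : ∀ b i, Function.update x (q (Sum.inr (Sum.inr t))) b (q (Sum.inr (Sum.inl i))) =
      x (q (Sum.inr (Sum.inl i))) := fun b i => Function.update_of_ne (by simp) _ _
  have ht : ∀ b,
      (fun s => Function.update x (q (Sum.inr (Sum.inr t))) b (q (Sum.inr (Sum.inr s)))) =
      Function.update (fun s => x (q (Sum.inr (Sum.inr s)))) t b := by
    intro b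
    ext s
    by_cases hs : s = t
    · subst hs; simp
    · rw [Function.update_of_ne hs, Function.update_of_ne]
      simpa using hs
  have hr : ∀ b, IndexReady q (Function.update x (q (Sum.inr (Sum.inr t))) b) ↔
      IndexReady q x := fun b => by simp only [IndexReady, hi]
  by_cases h : IndexReady q x
  · rw [encode_of_ready h]
    refine Finset.sum_congr rfl fun b _ => ?_
    rw [encode_of_ready ((hr b).2 h), ht]
    simp only [hw]
  · rw [encode_of_not_ready h]
    refine Finset.sum_eq_zero fun b _ => ?_
    rw [encode_of_not_ready (fun h' => h ((hr b).1 h')), mul_zero]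

/-- The reflection on the working qubits in `S`, controlled on the test qubit `t` being `0`. -/
def reflectionGate [DecidableEq Wk] [DecidableEq τ] [DecidableEq I] (S : Finset Wk) (t : τ) :
    Gate nv nh a N n :=
  .reflection ((insert (Sum.inr (Sum.inr t)) (S.map Function.Embedding.inl)).map q.toEmbedding)

/-- Adding the test qubit to the reflected set is already a control on its value 0. -/
theorem act_reflectionGate [DecidableEq Wk] [DecidableEq τ] [DecidableEq I] (S : Finset Wk) (t : τ)
    (Φ : Bits τ → Bits Wk → ℂ) :
    (reflectionGate q S t : Gate nv nh a N n).act W H (encode q Φ) =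
      encode q (fun y => if y t = false then reflect S (Φ y) else Φ y) := by
  ext x
  have h : (∀ p ∈ (insert (Sum.inr (Sum.inr t))
      (S.map (Function.Embedding.inl : Wk ↪ Wk ⊕ (I ⊕ I) ⊕ τ))).map q.toEmbedding, x p = false) ↔
      (x (q (Sum.inr (Sum.inr t))) = false ∧ ∀ w ∈ S, x (q (Sum.inl w)) = false) := by
    simp only [Finset.forall_mem_map, Finset.forall_mem_insert]
    rfl
  have hact : (reflectionGate q S t : Gate nv nh a N n).act W H (encode q Φ) x =
      if (x (q (Sum.inr (Sum.inr t))) = false ∧ ∀ w ∈ S, x (q (Sum.inl w)) = false) then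
        -encode q Φ x else encode q Φ x := by
    simp only [reflectionGate, Gate.act, h]
  rw [hact]
  by_cases hr : IndexReady q x
  · rw [encode_of_ready hr, encode_of_ready hr]
    by_cases ht : x (q (Sum.inr (Sum.inr t))) = false
    · simp [ht, reflect_apply]
    · simp [ht]
  · rw [encode_of_not_ready hr, encode_of_not_ready hr]
    simp

end Single

/-! ### One-qubit gates and the polynomial of a Hadamard test -/

/-- The Hadamard gate. -/
def hadamardGate : Matrix Bool Bool ℂ :=
  Matrix.of fun a b => if a && b then -((√2 / 2 : ℝ) : ℂ) else ((√2 / 2 : ℝ) : ℂ)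

/-- The bit flip. -/
def flipGate : Matrix Bool Bool ℂ := Matrix.of fun a b => if a = b then 0 else 1

/-- The relative phase of a Hadamard test: `i` for a sine and `1` for a cosine. -/
def testPhase (s : Bool) : ℂ := if s then Complex.I else 1

/-- The phase gate of a Hadamard test. -/
def phaseGate (s : Bool) : Matrix Bool Bool ℂ :=
  Matrix.diagonal fun b => if b then testPhase s else 1

theorem sqrt_two_half_sq : ((√2 / 2 : ℝ) : ℂ) * ((√2 / 2 : ℝ) : ℂ) = 1 / 2 := by
  rw [← Complex.ofReal_mul]
  rw [show √2 / 2 * (√2 / 2) = 1 / 2 by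
    have := Real.mul_self_sqrt (show (0 : ℝ) ≤ 2 by norm_num)
    linarith]
  simp

theorem hadamardGate_mem : hadamardGate ∈ Matrix.unitaryGroup Bool ℂ := by
  rw [Matrix.mem_unitaryGroup_iff]
  have h := sqrt_two_half_sq
  ext i j
  cases i <;> cases j <;>
    simp only [Matrix.mul_apply, Fintype.sum_bool, Matrix.star_apply, hadamardGate,
      Matrix.of_apply, Bool.and_true, Bool.and_false, Bool.false_eq_true, if_true, if_false,
      Complex.star_def, map_neg, Complex.conj_ofReal, Matrix.one_apply, Bool.true_eq_false] <;>
    first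
    | linear_combination (2 : ℂ) * h
    | ring

theorem flipGate_mem : flipGate ∈ Matrix.unitaryGroup Bool ℂ := by
  rw [Matrix.mem_unitaryGroup_iff]
  ext i j
  cases i <;> cases j <;>
    simp [Matrix.mul_apply, Matrix.star_apply, flipGate]

theorem phaseGate_mem (s : Bool) : phaseGate s ∈ Matrix.unitaryGroup Bool ℂ := by
  rw [Matrix.mem_unitaryGroup_iff, phaseGate, star_eq_conjTranspose,
    Matrix.diagonal_conjTranspose, Matrix.diagonal_mul_diagonal, ← Matrix.diagonal_one]
  congr 1
  ext b
  cases b <;> cases s <;> simp [testPhase]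

/-- The sign of a bit as a complex number. -/
theorem coe_bitSign (b : Bool) : ((bitSign b : ℝ) : ℂ) = if b then -1 else 1 := by
  cases b <;> simp [bitSign]

open Polynomial in
/-- The polynomial in the Grover iterate which a Hadamard test with outcome `b` applies. -/
def testPoly (m : ℕ) (s b : Bool) : ℂ[X] :=
  C (1 / 2) * (X ^ m + C (bitSign b * testPhase s))

-- At the eigenvalue e^{iy} the outcome probability is that of a bit whose sign has mean cos(my) or
-- sin(my); this links the circuit to `bitWeight`.
open Polynomial in
theorem norm_sq_eval_testPoly (m : ℕ) (s b : Bool) (y : ℝ) :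
    ‖(testPoly m s b).eval (Complex.exp (y * Complex.I))‖ ^ 2 =
      (1 + bitSign b * (if s then Real.sin (m * y) else Real.cos (m * y))) / 2 := by
  have h1 : Complex.exp (y * Complex.I) ^ m =
      ((Real.cos (m * y) : ℝ) : ℂ) + ((Real.sin (m * y) : ℝ) : ℂ) * Complex.I := by
    rw [← Complex.exp_nat_mul, ← mul_assoc, Complex.exp_mul_I]
    push_cast
    rfl
  have h2 := Real.sin_sq_add_cos_sq (m * y)
  simp only [testPoly, eval_mul, eval_C, eval_add, eval_pow, eval_X, h1]
  rw [← Complex.normSq_eq_norm_sq, Complex.normSq_apply]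
  cases s <;> cases b <;>
    simp only [testPhase, bitSign, Bool.false_eq_true, if_true, if_false, Complex.mul_re,
      Complex.mul_im, Complex.add_re, Complex.add_im, Complex.ofReal_re, Complex.ofReal_im,
      Complex.I_re, Complex.I_im, Complex.one_re, Complex.one_im, Complex.div_ofNat_re,
      Complex.div_ofNat_im] <;>
    linear_combination h2 / 4

/-! ### Hadamard tests of powers of the Grover iterate -/

section Tests

variable {Wk I τ : Type} {n : ℕ} (q : Wk ⊕ (I ⊕ I) ⊕ τ ≃ Fin n) [Fintype Wk] [DecidableEq Wk]
  [DecidableEq I] [DecidableEq τ]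
variable {nv nh a N : ℕ} (W : Op (Fin nv ⊕ Fin a)) (H : Fin N → Op (Fin nv ⊕ Fin nh))

/-- The circuit `c` acts on encoded states as the operator `A` on the working qubits. -/
def ActsAs (c : Circuit nv nh a N n) (A : Module.End ℂ (Bits Wk → ℂ)) : Prop :=
  ∀ Φ : Bits τ → Bits Wk → ℂ, Circuit.act c W H (encode q Φ) = encode q fun y => A (Φ y)

/-- The Grover iterate, controlled on the test qubit `t` being `0`. -/
def groverGates (c c' : Circuit nv nh a N n) (S : Finset Wk) (t : τ) : Circuit nv nh a N n :=
  reflectionGate q S t :: (c' ++ reflectionGate q Finset.univ t :: c)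

/-- A Hadamard test of the `m`-th power of the Grover iterate. -/
def testGates (c c' : Circuit nv nh a N n) (S : Finset Wk) (m : ℕ) (s : Bool) (t : τ) :
    Circuit nv nh a N n :=
  .single (q (Sum.inr (Sum.inr t))) hadamardGate hadamardGate_mem ::
    ((List.replicate m (groverGates q c c' S t)).flatten ++
      [.single (q (Sum.inr (Sum.inr t))) (phaseGate s) (phaseGate_mem s),
        .single (q (Sum.inr (Sum.inr t))) hadamardGate hadamardGate_mem])

variable {W H} {c c' : Circuit nv nh a N n} {A A' : Module.End ℂ (Bits Wk → ℂ)}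

/-- If the test qubit is 1, both reflections are idle and the remaining `c'` and `c` cancel. Hence
no query has to be controlled. -/
theorem act_groverGates (hc : ActsAs q W H c A) (hc' : ActsAs q W H c' A') (hAA : A * A' = 1)
    (S : Finset Wk) (t : τ) (Φ : Bits τ → Bits Wk → ℂ) :
    Circuit.act (groverGates q c c' S t) W H (encode q Φ) =
      encode q fun y => if y t = false then grover A A' S (Φ y) else Φ y := by
  rw [groverGates, Circuit.act_cons, act_reflectionGate, Circuit.act_append, hc',
    Circuit.act_cons, act_reflectionGate, hc]
  congr 1
  ext1 y
  by_cases h : y t = false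
  · simp only [h, if_true]
    rfl
  · simp only [if_neg h]
    rw [← Module.End.mul_apply, hAA, Module.End.one_apply]

theorem act_replicate_groverGates (hc : ActsAs q W H c A) (hc' : ActsAs q W H c' A')
    (hAA : A * A' = 1) (S : Finset Wk) (t : τ) (m : ℕ) (Φ : Bits τ → Bits Wk → ℂ) :
    Circuit.act (List.replicate m (groverGates q c c' S t)).flatten W H (encode q Φ) =
      encode q fun y => if y t = false then (grover A A' S ^ m) (Φ y) else Φ y := by
  induction m generalizing Φ with
  | zero =>
    rw [List.replicate_zero, List.flatten_nil, Circuit.act_nil]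
    simp
  | succ m ih =>
    rw [List.replicate_succ, List.flatten_cons, Circuit.act_append,
      act_groverGates q hc hc' hAA, ih]
    congr 1
    ext1 y
    by_cases h : y t = false
    · simp [h, pow_succ, Module.End.mul_apply]
    · simp [h]

-- The first Hadamard gate splits a fresh test qubit; branch 0 receives G^m and branch 1 the phase,
-- and the last gate adds or subtracts the branches. The outcome `b` thus applies (G^m + (−1)^b ·
-- phase)/2 to the working qubits.
open Polynomial in
theorem act_testGates (hc : ActsAs q W H c A) (hc' : ActsAs q W H c' A') (hAA : A * A' = 1)
    (S : Finset Wk) (m : ℕ) (s : Bool) (t : τ) (Φ : Bits τ → Bits Wk → ℂ)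
    (hΦ : ∀ y, y t = true → Φ y = 0) :
    Circuit.act (testGates q c c' S m s t) W H (encode q Φ) =
      encode q fun y =>
        aeval (grover A A' S) (testPoly m s (y t)) (Φ (Function.update y t false)) := by
  rw [testGates, Circuit.act_cons, act_single_test, Circuit.act_append,
    act_replicate_groverGates q hc hc' hAA, Circuit.act_cons, act_single_test, Circuit.act_cons,
    act_single_test, Circuit.act_nil]
  congr 1
  ext y w
  have h0 : ∀ y, Φ (Function.update y t true) = 0 := fun y => hΦ _ (by simp)
  have h := sqrt_two_half_sq
  have hm : ∀ v : Bits Wk → ℂ, (fun w => ((√2 / 2 : ℝ) : ℂ) * v w) = ((√2 / 2 : ℝ) : ℂ) • v :=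
    fun v => rfl
  cases hy : y t
  all_goals
    simp only [Fintype.sum_bool, hadamardGate, phaseGate, Matrix.of_apply, h0,
      Function.update_idem, Function.update_self, Bool.and_true, Bool.and_false, if_true,
      Bool.false_eq_true, if_false, Pi.zero_apply, mul_zero, zero_add, hm, map_smul,
      Pi.smul_apply, smul_eq_mul, Matrix.diagonal_apply, Bool.true_eq_false, testPoly, map_mul,
      aeval_C, Module.End.mul_apply, Module.algebraMap_end_apply, map_add, map_pow, aeval_X,
      LinearMap.add_apply, Pi.add_apply, coe_bitSign, zero_mul, add_zero, one_mul]
  · linear_combination ((grover A A' S ^ m) (Φ (Function.update y t false)) w) * h +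
      (testPhase s * Φ (Function.update y t false) w) * h
  · linear_combination ((grover A A' S ^ m) (Φ (Function.update y t false)) w) * h -
      (testPhase s * Φ (Function.update y t false) w) * h

open Polynomial in
/-- The state after the tests in `T`. -/
def testState (G : Module.End ℂ (Bits Wk → ℂ)) (ψ : Bits Wk → ℂ) (f : τ → Bool → ℂ[X])
    (T : Finset τ) : Bits τ → Bits Wk → ℂ :=
  open Classical in fun y =>
    if ∀ t ∉ T, y t = false then aeval G (∏ t ∈ T, f t (y t)) ψ else 0

-- All tests act on the same working state through polynomials in one operator, so the polynomials
-- multiply. The support condition in `testState` records that the tests outside `T` are still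
-- fresh.
open Polynomial in
theorem act_tests (hc : ActsAs q W H c A) (hc' : ActsAs q W H c' A') (hAA : A * A' = 1)
    (S : Finset Wk) (m : τ → ℕ) (s : τ → Bool) (ψ : Bits Wk → ℂ) (l : List τ) (T : Finset τ)
    (hl : l.Nodup) (hT : ∀ t ∈ l, t ∉ T) :
    Circuit.act (l.flatMap fun t => testGates q c c' S (m t) (s t) t) W H
      (encode q (testState (grover A A' S) ψ (fun t => testPoly (m t) (s t)) T)) =
      encode q (testState (grover A A' S) ψ (fun t => testPoly (m t) (s t))
        (T ∪ l.toFinset)) := by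
  induction l generalizing T with
  | nil => simp [Circuit.act_nil]
  | cons t l ih =>
    have htT : t ∉ T := hT t (by simp)
    rw [List.flatMap_cons, Circuit.act_append, act_testGates q hc hc' hAA]
    · have hstep : (fun y => aeval (grover A A' S) (testPoly (m t) (s t) (y t))
          (testState (grover A A' S) ψ (fun t => testPoly (m t) (s t)) T
            (Function.update y t false))) =
          testState (grover A A' S) ψ (fun t => testPoly (m t) (s t)) (insert t T) := by
        ext1 y
        have hiff : (∀ u ∉ T, Function.update y t false u = false) ↔
            ∀ u ∉ insert t T, y u = false := by
          constructor
          · intro h u hu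
            rw [Finset.mem_insert, not_or] at hu
            rw [← h u hu.2, Function.update_of_ne hu.1]
          · intro h u hu
            by_cases hut : u = t
            · subst hut; simp
            · rw [Function.update_of_ne hut]
              exact h u (by simp [hut, hu])
        have hprod : ∏ u ∈ T, testPoly (m u) (s u) (Function.update y t false u) =
            ∏ u ∈ T, testPoly (m u) (s u) (y u) := by
          refine Finset.prod_congr rfl fun u hu => ?_
          rw [Function.update_of_ne]
          rintro rfl
          exact htT hu
        unfold testState
        by_cases h : ∀ u ∉ insert t T, y u = false
        · rw [if_pos h, if_pos (hiff.2 h), hprod, Finset.prod_insert htT, map_mul,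
            Module.End.mul_apply]
        · rw [if_neg h, if_neg (fun h' => h (hiff.1 h')), map_zero]
      rw [hstep, ih (insert t T) (List.nodup_cons.1 hl).2]
      · congr 2
        ext u
        simp only [Finset.mem_union, Finset.mem_insert, List.mem_toFinset, List.mem_cons]
        tauto
      · intro u hu
        rw [Finset.mem_insert, not_or]
        exact ⟨fun h => (List.nodup_cons.1 hl).1 (h ▸ hu), hT u (by simp [hu])⟩
    · intro y hy
      refine if_neg fun h => ?_
      rw [h t htT] at hy
      exact absurd hy (by simp)

end Tests

/-! ### Initialisation of the index qubits and the complete estimation circuit -/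

section Flip

variable {nv nh a N n : ℕ} (W : Op (Fin nv ⊕ Fin a)) (H : Fin N → Op (Fin nv ⊕ Fin nh))

theorem act_flipGate (p : Fin n) (z : Bits (Fin n)) :
    (Gate.single p flipGate flipGate_mem : Gate nv nh a N n).act W H (Pi.single z 1) =
      Pi.single (Function.update z p (!z p)) 1 := by
  ext x
  have h : Function.update x p (!x p) = z ↔ x = Function.update z p (!z p) := by
    constructor
    · rintro rfl; simp
    · rintro rfl; simp
  simp only [Gate.act, Fintype.sum_bool, Pi.single_apply, ← h]
  cases hx : x p <;> simp [flipGate]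

theorem act_flipGates (l : List (Fin n)) (hl : l.Nodup) (z : Bits (Fin n))
    (hz : ∀ p ∈ l, z p = false) :
    Circuit.act (l.map fun p => (Gate.single p flipGate flipGate_mem : Gate nv nh a N n)) W H
      (Pi.single z 1) = Pi.single (fun p => if p ∈ l then true else z p) 1 := by
  induction l generalizing z with
  | nil => simp [Circuit.act_nil]
  | cons p l ih =>
    have hp : p ∉ l := (List.nodup_cons.1 hl).1
    rw [List.map_cons, Circuit.act_cons, act_flipGate, ih (List.nodup_cons.1 hl).2]
    · congr 1
      ext r
      by_cases hr : r = p
      · subst hr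
        simp [hp, hz r (by simp)]
      · simp [hr]
    · intro r hr
      rw [Function.update_of_ne (by rintro rfl; exact hp hr)]
      exact hz r (by simp [hr])

end Flip

section Run

variable {Wk I τ : Type} {n : ℕ} (q : Wk ⊕ (I ⊕ I) ⊕ τ ≃ Fin n) [Fintype Wk] [DecidableEq Wk]
  [Fintype I] [DecidableEq I] [Fintype τ] [DecidableEq τ]
variable {nv nh a N : ℕ} (W : Op (Fin nv ⊕ Fin a)) (H : Fin N → Op (Fin nv ⊕ Fin nh))

/-- Sets the index qubits of the second family to `1`. -/
def indexGates : Circuit nv nh a N n :=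
  (((Finset.univ : Finset I).toList.map fun i => q (Sum.inr (Sum.inl (Sum.inr i))))).map
    fun p => .single p flipGate flipGate_mem

omit [DecidableEq Wk] [DecidableEq I] [DecidableEq τ] in
theorem act_indexGates :
    Circuit.act (indexGates q : Circuit nv nh a N n) W H (Pi.single (fun _ => false) 1) =
      encode q (open Classical in fun y =>
        if ∀ t, y t = false then Pi.single (fun _ => false) 1 else 0) := by
  rw [indexGates, act_flipGates]
  · ext x
    by_cases hr : IndexReady q x
    · rw [encode_of_ready hr, Pi.single_apply]
      have hiff : (x = fun p => if p ∈ (Finset.univ : Finset I).toList.map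
          (fun i => q (Sum.inr (Sum.inl (Sum.inr i)))) then true else false) ↔
          (∀ t, x (q (Sum.inr (Sum.inr t))) = false) ∧ ∀ w, x (q (Sum.inl w)) = false := by
        constructor
        · intro h
          constructor
          · intro t; rw [h]; simp
          · intro w; rw [h]; simp
        · rintro ⟨ht, hw⟩
          ext p
          obtain ⟨s, rfl⟩ := q.surjective p
          rcases s with w | (i | i) | t
          · simp [hw]
          · rw [hr]; simp
          · rw [hr]; simp
          · simp [ht]
      by_cases ht : ∀ t, x (q (Sum.inr (Sum.inr t))) = false
      · by_cases hw : ∀ w, x (q (Sum.inl w)) = false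
        · rw [if_pos (hiff.2 ⟨ht, hw⟩), if_pos ht, Pi.single_apply, if_pos (funext hw)]
        · rw [if_neg (fun h => hw (hiff.1 h).2), if_pos ht, Pi.single_apply,
            if_neg (fun h => hw (congrFun h))]
      · rw [if_neg (fun h => ht (hiff.1 h).1), if_neg ht, Pi.zero_apply]
    · rw [encode_of_not_ready hr, Pi.single_apply, if_neg]
      rintro rfl
      refine hr ?_
      rintro (i | i) <;> simp
  · refine (Finset.nodup_toList _).map ?_
    intro i j h
    simpa using h
  · simp

/-- Phase estimation for the Grover iterate by Hadamard tests on a single copy of the state. -/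
def estimationCircuit (c c' : Circuit nv nh a N n) (S : Finset Wk) (m : τ → ℕ) (s : τ → Bool) :
    Circuit nv nh a N n :=
  indexGates q ++
    (c ++ (Finset.univ : Finset τ).toList.flatMap fun t => testGates q c c' S (m t) (s t) t)

variable {W H} {c c' : Circuit nv nh a N n} {A A' : Module.End ℂ (Bits Wk → ℂ)}

open Polynomial in
theorem run_estimationCircuit (hc : ActsAs q W H c A) (hc' : ActsAs q W H c' A')
    (hAA : A * A' = 1) (S : Finset Wk) (m : τ → ℕ) (s : τ → Bool) :
    Circuit.run (estimationCircuit q c c' S m s) W H = encode q fun y =>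
      aeval (grover A A' S) (∏ t, testPoly (m t) (s t) (y t)) (A (Pi.single (fun _ => false) 1)) := by
  rw [Circuit.run_eq, estimationCircuit, Circuit.act_append, act_indexGates, Circuit.act_append,
    hc]
  have h0 : (fun y => A (open Classical in if ∀ t : τ, y t = false then
        (Pi.single (fun _ => false) 1 : Bits Wk → ℂ) else 0)) =
      testState (grover A A' S) (A (Pi.single (fun _ => false) 1))
        (fun t => testPoly (m t) (s t)) ∅ := by
    ext1 y
    unfold testState
    by_cases h : ∀ t, y t = false
    · simp [h]
    · rw [if_neg h, if_neg (fun h' => h fun t => h' t (by simp)), map_zero]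
  rw [h0, act_tests q hc hc' hAA S m s _ _ _ (Finset.nodup_toList _) (by simp)]
  congr 1
  ext1 y
  simp [testState]

/-- The marginal law of the test qubits: index qubits are deterministic and working qubits are
summed over. -/
theorem sum_norm_sq_encode (Φ : Bits τ → Bits Wk → ℂ) (E : Set (Bits τ)) :
    (open Classical in ∑ x : Bits (Fin n),
      if x ∈ {x | (fun t => x (q (Sum.inr (Sum.inr t)))) ∈ E} then ‖encode q Φ x‖ ^ 2 else 0) =
      open Classical in ∑ y, if y ∈ E then ∑ w, ‖Φ y w‖ ^ 2 else 0 := by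
  classical
  let b : Bits (I ⊕ I) := Sum.elim (fun _ => false) (fun _ => true)
  let F : (Bits Wk × Bits ((I ⊕ I) ⊕ τ)) ≃ Bits (Fin n) :=
    (Equiv.sumArrowEquivProdArrow Wk ((I ⊕ I) ⊕ τ) Bool).symm.trans
      (Equiv.arrowCongr q (Equiv.refl Bool))
  have hw : ∀ p w, F p (q (Sum.inl w)) = p.1 w := fun p w => by
    simp [F, Equiv.sumArrowEquivProdArrow]
  have hi : ∀ p i, F p (q (Sum.inr i)) = p.2 i := fun p i => by
    simp [F, Equiv.sumArrowEquivProdArrow]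
  have hval : ∀ (w : Bits Wk) (u : Bits (I ⊕ I)) (y : Bits τ),
      encode q Φ (F (w, Sum.elim u y)) = if u = b then Φ y w else 0 := by
    intro w u y
    have hr : IndexReady q (F (w, Sum.elim u y)) ↔ u = b := by
      simp only [IndexReady, hi, Sum.elim_inl, b]
      exact funext_iff.symm
    by_cases h : u = b
    · rw [encode_of_ready (hr.2 h), if_pos h]
      simp only [hw, hi, Sum.elim_inr]
    · rw [encode_of_not_ready (fun h' => h (hr.1 h')), if_neg h]
  rw [← F.sum_comp, Fintype.sum_prod_type]
  have h1 : ∀ w : Bits Wk, (∑ p : Bits ((I ⊕ I) ⊕ τ), if F (w, p) ∈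
      {x | (fun t => x (q (Sum.inr (Sum.inr t)))) ∈ E} then ‖encode q Φ (F (w, p))‖ ^ 2 else 0) =
      ∑ y : Bits τ, if y ∈ E then ‖Φ y w‖ ^ 2 else 0 := by
    intro w
    rw [← (Equiv.sumArrowEquivProdArrow (I ⊕ I) τ Bool).symm.sum_comp, Fintype.sum_prod_type,
      Finset.sum_eq_single b]
    · refine Finset.sum_congr rfl fun y _ => ?_
      have : (Equiv.sumArrowEquivProdArrow (I ⊕ I) τ Bool).symm (b, y) = Sum.elim b y := rfl
      rw [this, hval, if_pos rfl]
      simp only [Set.mem_ofPred_eq, hi, Sum.elim_inr]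
    · intro u _ hu
      refine Finset.sum_eq_zero fun y _ => ?_
      have : (Equiv.sumArrowEquivProdArrow (I ⊕ I) τ Bool).symm (u, y) = Sum.elim u y := rfl
      rw [this, hval, if_neg hu]
      simp
    · simp
  rw [Finset.sum_congr rfl fun w _ => h1 w, Finset.sum_comm]
  refine Finset.sum_congr rfl fun y _ => ?_
  split_ifs <;> simp

end Run

/-! ### Success probability and cost of amplitude estimation -/

section Estimation

variable {Wk I : Type} {n J : ℕ} (q : Wk ⊕ (I ⊕ I) ⊕ Test J ≃ Fin n) [Fintype Wk] [DecidableEq Wk]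
  [Fintype I] [DecidableEq I] {nv nh a N : ℕ} {W : Op (Fin nv ⊕ Fin a)}
  {H : Fin N → Op (Fin nv ⊕ Fin nh)} {c c' : Circuit nv nh a N n}
  {A A' : Module.End ℂ (Bits Wk → ℂ)}

/-- The circuit that estimates the amplitude with which `c` prepares `0` on the qubits in `S`. -/
def amplitudeCircuit (c c' : Circuit nv nh a N n) (S : Finset Wk) : Circuit nv nh a N n :=
  estimationCircuit q c c' S (fun t => 4 ^ t.1.1) (fun t => t.2.1)

open Polynomial in
theorem norm_sq_eval_prod_testPoly (y : ℝ) (x : Test J → Bool) :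
    ‖(∏ t : Test J, testPoly (4 ^ t.1.1) t.2.1 (x t)).eval (Complex.exp (y * Complex.I))‖ ^ 2 =
      bitWeight (testMean y) x := by
  rw [eval_prod, norm_prod, ← Finset.prod_pow, bitWeight]
  refine Finset.prod_congr rfl fun t _ => ?_
  rw [norm_sq_eval_testPoly]
  simp [testMean]

/-- The outcomes follow the equal mixture of the laws for the phases y and −y. As |cos(y/2)| is even
in y, the estimator succeeds under both. -/
theorem amplitudeCircuit_prob (hc : ActsAs q W H c A) (hc' : ActsAs q W H c' A')
    (hAA : A' * A = 1) (hAA' : A * A' = 1)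
    (hadj : ∀ φ ψ, star (A φ) ⬝ᵥ ψ = star φ ⬝ᵥ A' ψ) (S : Finset Wk) :
    15 / 16 ≤ (amplitudeCircuit q c c' S).prob W H
      {x | |estimateAmplitude (fun t => x (q (Sum.inr (Sum.inr t)))) -
        √(zeroProb S (A (Pi.single (fun _ => false) 1)))| ≤ 1 / 4 ^ J} := by
  classical
  set ψ := A (Pi.single (fun _ => false) 1) with hψdef
  have hψ : star ψ ⬝ᵥ ψ = 1 := by
    rw [hadj, hψdef, ← Module.End.mul_apply, hAA]; simp [dotProduct, Pi.single_apply]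
  have hP0 := zeroProb_nonneg S ψ
  have hP1 := zeroProb_le_one S ψ hψ
  set P := zeroProb S ψ with hP
  set y := Real.arccos (2 * P - 1) with hydef
  have hy : Real.cos y = 2 * P - 1 := Real.cos_arccos (by linarith) (by linarith)
  have hsq : Real.cos (y / 2) ^ 2 = P := by
    rw [Real.cos_sq]
    rw [mul_div_cancel₀ y two_ne_zero, hy]
    ring
  have hr : |Real.cos (y / 2)| = √P := by
    rw [← hsq, Real.sqrt_sq_eq_abs]
  have hr' : |Real.cos (-y / 2)| = √P := by
    rw [neg_div, Real.cos_neg, hr]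
  have h1 := estimateAmplitude_prob (J := J) y _ hr
  have h2 := estimateAmplitude_prob (J := J) (-y) _ hr'
  unfold Circuit.prob amplitudeCircuit
  rw [run_estimationCircuit q hc hc' hAA']
  have hsum := sum_norm_sq_encode q (fun x => Polynomial.aeval (grover A A' S)
    (∏ t : Test J, testPoly (4 ^ t.1.1) t.2.1 (x t)) (A (Pi.single (fun _ => false) 1)))
    {x | |estimateAmplitude x - √P| ≤ 1 / 4 ^ J}
  refine le_of_le_of_eq ?_ hsum.symm
  have hnorm : ∀ x : Test J → Bool, ∑ w, ‖Polynomial.aeval (grover A A' S)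
      (∏ t : Test J, testPoly (4 ^ t.1.1) t.2.1 (x t)) (A (Pi.single (fun _ => false) 1)) w‖ ^ 2 =
      (bitWeight (testMean y) x + bitWeight (testMean (-y)) x) / 2 := by
    intro x
    rw [norm_sq_aeval_grover hAA hAA' hadj S y hy, norm_sq_eval_prod_testPoly,
      norm_sq_eval_prod_testPoly]
  simp only [hnorm, Set.mem_ofPred_eq]
  have hfin : ∀ x : Test J → Bool, (if |estimateAmplitude x - √P| ≤ 1 / 4 ^ J then
      (bitWeight (testMean y) x + bitWeight (testMean (-y)) x) / 2 else 0) =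
      (bitWeight (testMean y) x * (if |estimateAmplitude x - √P| ≤ 1 / 4 ^ J then 1 else 0) +
      bitWeight (testMean (-y)) x * (if |estimateAmplitude x - √P| ≤ 1 / 4 ^ J then 1 else 0)) / 2 := by
    intro x
    split_ifs <;> ring
  rw [Finset.sum_congr rfl fun x _ => hfin x, ← Finset.sum_div, Finset.sum_add_distrib]
  linarith

/-- The total number of Grover iterates. Level j needs 2 · 1024 · 2^(J−j) · 4^j = 2048 · 2^J · 2^j
of them, and the geometric sum is dominated by its top level. -/
theorem sum_test_le (J : ℕ) : ∑ t : Test J, 4 ^ t.1.1 ≤ 4096 * 4 ^ J := by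
  have h : ∀ j : Fin (J + 1), ∑ _p : Bool × Fin (1024 * 2 ^ (J - j.1)), 4 ^ j.1 =
      2048 * 2 ^ J * 2 ^ j.1 := by
    intro j
    have hj : 2 ^ J = 2 ^ (J - j.1) * 2 ^ j.1 := by
      rw [← pow_add, Nat.sub_add_cancel (Nat.lt_succ_iff.1 j.2)]
    rw [Finset.sum_const, Finset.card_univ, Fintype.card_prod, Fintype.card_bool, Fintype.card_fin,
      smul_eq_mul, hj, show 4 = 2 * 2 from rfl, mul_pow]
    ring
  rw [Fintype.sum_sigma, Finset.sum_congr rfl fun j _ => h j, ← Finset.mul_sum,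
    Fin.sum_univ_eq_sum_range (fun j => 2 ^ j) (J + 1)]
  have hg : ∑ j ∈ Finset.range (J + 1), 2 ^ j ≤ 2 * 2 ^ J := by
    have := Nat.geomSum_eq (le_refl 2) (J + 1)
    rw [this, pow_succ]
    omega
  calc _ ≤ 2048 * 2 ^ J * (2 * 2 ^ J) := Nat.mul_le_mul_left _ hg
    _ = _ := by rw [show 4 = 2 * 2 from rfl, mul_pow]; ring

theorem card_test_le (J : ℕ) : Fintype.card (Test J) ≤ 4096 * 4 ^ J := by
  refine le_trans ?_ (sum_test_le J)
  rw [← Finset.card_univ, Finset.card_eq_sum_ones]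
  exact Finset.sum_le_sum fun t _ => Nat.one_le_pow _ _ (by norm_num)

omit [Fintype Wk] [DecidableEq Wk] [DecidableEq I] in
theorem cost_indexGates : (indexGates q : Circuit nv nh a N n).cost = Fintype.card I := by
  simp [Circuit.cost, indexGates, Function.comp_def, Gate.cost]

omit [Fintype Wk] [DecidableEq Wk] [DecidableEq I] in
theorem reflections_indexGates : (indexGates q : Circuit nv nh a N n).reflections = 0 := by
  simp [Circuit.reflections, indexGates, Function.comp_def, Gate.reflections]

omit [Fintype Wk] [DecidableEq Wk] [DecidableEq I] in
theorem reflectionSize_indexGates :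
    (indexGates q : Circuit nv nh a N n).reflectionSize = 0 := by
  simp [Circuit.reflectionSize, indexGates, Function.comp_def, Gate.reflectionSize]

theorem sum_map_flatMap {α β : Type} (f : β → ℕ) (g : α → List β) (l : List α) :
    ((l.flatMap g).map f).sum = (l.map fun x => ((g x).map f).sum).sum := by
  induction l with
  | nil => simp
  | cons x l ih => simp [List.flatMap_cons, ih]

theorem sum_map_flatten_replicate {β : Type} (f : β → ℕ) (l : List β) (m : ℕ) :
    (((List.replicate m l).flatten).map f).sum = m * (l.map f).sum := by
  simp

theorem cost_amplitudeCircuit_le (c c' : Circuit nv nh a N n) (S : Finset Wk) {K : ℕ}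
    (hc : c.cost ≤ K) (hc' : c'.cost ≤ K) :
    (amplitudeCircuit q c c' S).cost ≤ Fintype.card I + K + 4096 * 4 ^ J * (3 + 2 * K) := by
  -- The 3 counts two Hadamard gates and one phase gate; each iterate contains `c` and `c'` once,
  -- its reflections being counted separately.
  have htest : ∀ t : Test J, ((testGates q c c' S (4 ^ t.1.1) t.2.1 t).map Gate.cost).sum ≤
      3 + 4 ^ t.1.1 * (2 * K) := by
    intro t
    simp only [testGates, groverGates, List.map_cons, List.map_append, List.sum_cons,
      List.sum_append, sum_map_flatten_replicate, List.map_nil, List.sum_nil, Gate.cost,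
      reflectionGate]
    have : 4 ^ t.1.1 * (0 + ((c'.map Gate.cost).sum + (0 + (c.map Gate.cost).sum))) ≤
        4 ^ t.1.1 * (2 * K) := by
      apply Nat.mul_le_mul_left
      unfold Circuit.cost at hc hc'
      omega
    omega
  have hsum : Circuit.cost ((Finset.univ : Finset (Test J)).toList.flatMap fun t : Test J =>
      testGates q c c' S (4 ^ t.1.1) t.2.1 t) ≤
      4096 * 4 ^ J * (3 + 2 * K) := by
    rw [Circuit.cost, sum_map_flatMap, Finset.sum_map_toList]
    calc _ ≤ ∑ t : Test J, (3 + 4 ^ t.1.1 * (2 * K)) := Finset.sum_le_sum fun t _ => htest t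
      _ = Fintype.card (Test J) * 3 + (∑ t : Test J, 4 ^ t.1.1) * (2 * K) := by
          rw [Finset.sum_add_distrib, ← Finset.sum_mul]; simp
      _ ≤ 4096 * 4 ^ J * 3 + 4096 * 4 ^ J * (2 * K) :=
          Nat.add_le_add (Nat.mul_le_mul_right _ (card_test_le J))
            (Nat.mul_le_mul_right _ (sum_test_le J))
      _ = _ := by ring
  rw [amplitudeCircuit, estimationCircuit, Circuit.cost_append, Circuit.cost_append,
    cost_indexGates]
  omega

theorem reflections_amplitudeCircuit_le (c c' : Circuit nv nh a N n) (S : Finset Wk)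
    (hc : c.reflections = 0) (hc' : c'.reflections = 0) :
    (amplitudeCircuit q c c' S).reflections ≤ 8192 * 4 ^ J := by
  have htest : ∀ t : Test J, ((testGates q c c' S (4 ^ t.1.1) t.2.1 t).map Gate.reflections).sum =
      4 ^ t.1.1 * 2 := by
    intro t
    unfold Circuit.reflections at hc hc'
    simp only [testGates, groverGates, List.map_cons, List.map_append, List.sum_cons,
      List.sum_append, sum_map_flatten_replicate, List.map_nil, List.sum_nil, Gate.reflections,
      reflectionGate, hc, hc']
    ring
  have hsum : Circuit.reflections ((Finset.univ : Finset (Test J)).toList.flatMap fun t : Test J =>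
      testGates q c c' S (4 ^ t.1.1) t.2.1 t) ≤
      8192 * 4 ^ J := by
    rw [Circuit.reflections, sum_map_flatMap, Finset.sum_map_toList,
      Finset.sum_congr rfl fun t _ => htest t, ← Finset.sum_mul]
    have := sum_test_le J
    omega
  rw [amplitudeCircuit, estimationCircuit, Circuit.reflections_append, Circuit.reflections_append,
    reflections_indexGates, hc]
  omega

theorem reflectionSize_amplitudeCircuit_le (c c' : Circuit nv nh a N n) (S : Finset Wk)
    (hc : c.reflectionSize = 0) (hc' : c'.reflectionSize = 0) :
    (amplitudeCircuit q c c' S).reflectionSize ≤ 8192 * 4 ^ J * (Fintype.card Wk + 1) := by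
  have hS : S.card ≤ Fintype.card Wk := Finset.card_le_univ S
  have htest : ∀ t : Test J,
      ((testGates q c c' S (4 ^ t.1.1) t.2.1 t).map Gate.reflectionSize).sum ≤
      4 ^ t.1.1 * (2 * (Fintype.card Wk + 1)) := by
    intro t
    unfold Circuit.reflectionSize at hc hc'
    simp only [testGates, groverGates, List.map_cons, List.map_append, List.sum_cons,
      List.sum_append, sum_map_flatten_replicate, List.map_nil, List.sum_nil, Gate.reflectionSize,
      reflectionGate, hc, hc', Finset.card_map, zero_add, add_zero]
    apply Nat.mul_le_mul_left
    rw [Finset.card_insert_of_notMem (by simp), Finset.card_insert_of_notMem (by simp),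
      Finset.card_map, Finset.card_map, Finset.card_univ]
    omega
  have hsum : Circuit.reflectionSize ((Finset.univ : Finset (Test J)).toList.flatMap fun t : Test J =>
      testGates q c c' S (4 ^ t.1.1) t.2.1 t) ≤
      8192 * 4 ^ J * (Fintype.card Wk + 1) := by
    rw [Circuit.reflectionSize, sum_map_flatMap, Finset.sum_map_toList]
    calc _ ≤ ∑ t : Test J, 4 ^ t.1.1 * (2 * (Fintype.card Wk + 1)) :=
          Finset.sum_le_sum fun t _ => htest t
      _ = (∑ t : Test J, 4 ^ t.1.1) * (2 * (Fintype.card Wk + 1)) := by rw [← Finset.sum_mul]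
      _ ≤ 4096 * 4 ^ J * (2 * (Fintype.card Wk + 1)) := Nat.mul_le_mul_right _ (sum_test_le J)
      _ = _ := by ring
  rw [amplitudeCircuit, estimationCircuit, Circuit.reflectionSize_append,
    Circuit.reflectionSize_append, reflectionSize_indexGates, hc]
  omega

end Estimation

/-! ### Exponentials of involutions and unitarity of the network -/

section Evolution

variable {R : Type} [Fintype R] [DecidableEq R]

/-- The two-dimensional algebra generated by an involution. -/
def involutionHom (H : Op R) (hH : H * H = 1) : ℂ × ℂ →+* Op R where
  toFun p := ((p.1 + p.2) / 2) • 1 + ((p.1 - p.2) / 2) • H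
  map_one' := by simp
  map_zero' := by simp
  map_mul' p s := by
    simp only [add_mul, mul_add, smul_mul_assoc, mul_smul_comm, hH, mul_one, one_mul,
      Prod.fst_mul, Prod.snd_mul]
    module
  map_add' p s := by
    simp only [Prod.fst_add, Prod.snd_add]
    module

/-- `involutionHom` evaluates a function of H from its values at the eigenvalues 1 and −1, and the
exponential commutes with continuous ring homomorphisms. So it suffices to exponentiate (−it, it) in
ℂ × ℂ. -/
theorem evolution_eq {H : Op R} (hH : H * H = 1) (t : ℝ) :
    evolution H t = (Real.cos t : ℂ) • (1 : Op R) - (Complex.I * Real.sin t) • H := by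
  have hcont : Continuous (involutionHom H hH) := by
    change Continuous fun p : ℂ × ℂ => ((p.1 + p.2) / 2) • (1 : Op R) + ((p.1 - p.2) / 2) • H
    fun_prop
  have h := open scoped Matrix.Norms.Operator in NormedSpace.map_exp (involutionHom H hH) hcont
    (-(Complex.I * (t : ℂ)), Complex.I * (t : ℂ))
  have h1 : involutionHom H hH (-(Complex.I * (t : ℂ)), Complex.I * (t : ℂ)) =
      (-(Complex.I * (t : ℂ))) • H := by
    change ((-(Complex.I * (t : ℂ)) + Complex.I * (t : ℂ)) / 2) • (1 : Op R) +
      ((-(Complex.I * (t : ℂ)) - Complex.I * (t : ℂ)) / 2) • H = _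
    module
  rw [h1] at h
  refine h.symm.trans ?_
  change (((NormedSpace.exp (-(Complex.I * (t : ℂ)), Complex.I * (t : ℂ))).1 +
    (NormedSpace.exp (-(Complex.I * (t : ℂ)), Complex.I * (t : ℂ))).2) / 2) • (1 : Op R) +
      (((NormedSpace.exp (-(Complex.I * (t : ℂ)), Complex.I * (t : ℂ))).1 -
    (NormedSpace.exp (-(Complex.I * (t : ℂ)), Complex.I * (t : ℂ))).2) / 2) • H = _
  rw [Prod.fst_exp, Prod.snd_exp, ← Complex.exp_eq_exp_ℂ,
    show -(Complex.I * (t : ℂ)) = (-t : ℂ) * Complex.I by ring,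
    show Complex.I * (t : ℂ) = (t : ℂ) * Complex.I by ring, Complex.exp_mul_I, Complex.exp_mul_I,
    Complex.cos_neg, Complex.sin_neg]
  push_cast
  module

theorem evolution_neg {H : Op R} (hH : H * H = 1) (hherm : H.IsHermitian) (t : ℝ) :
    evolution H (-t) = (evolution H t)ᴴ := by
  rw [evolution_eq hH, evolution_eq hH, conjTranspose_sub, conjTranspose_smul, conjTranspose_smul,
    conjTranspose_one, hherm]
  simp only [Complex.star_def, map_mul, Complex.conj_ofReal, Complex.conj_I, Real.cos_neg,
    Real.sin_neg]
  push_cast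
  module

theorem evolution_mul_conjTranspose {H : Op R} (hH : H * H = 1) (hherm : H.IsHermitian) (t : ℝ) :
    evolution H t * (evolution H t)ᴴ = 1 := by
  rw [← evolution_neg hH hherm, evolution_eq hH, evolution_eq hH]
  have h1 : (((Real.cos t : ℝ) : ℂ) • (1 : Op R) - (Complex.I * (Real.sin t : ℝ)) • H) *
      (((Real.cos (-t) : ℝ) : ℂ) • (1 : Op R) - (Complex.I * (Real.sin (-t) : ℝ)) • H) =
      (Complex.cos t ^ 2 - Complex.I ^ 2 * Complex.sin t ^ 2) • (1 : Op R) := by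
    simp only [Real.cos_neg, Real.sin_neg, sub_mul, mul_sub, smul_mul_assoc, mul_smul_comm, hH,
      mul_one, one_mul]
    push_cast
    module
  rw [h1, Complex.I_sq, neg_one_mul, sub_neg_eq_add, Complex.cos_sq_add_sin_sq, one_smul]

theorem network_mul_conjTranspose {N : ℕ} {H : Fin N → Op R} (hH : ∀ j, H j * H j = 1)
    (hherm : ∀ j, (H j).IsHermitian) (θ : Fin N → ℝ) :
    network H θ * (network H θ)ᴴ = 1 := by
  have hmem : network H θ ∈ Matrix.unitaryGroup (Bits R) ℂ := by
    unfold network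
    refine Submonoid.list_prod_mem _ fun U hU => ?_
    obtain ⟨j, rfl⟩ := (List.mem_ofFn' _ _).1 hU
    rw [Matrix.mem_unitaryGroup_iff]
    exact evolution_mul_conjTranspose (hH j) (hherm j) (θ j)
  exact Matrix.mem_unitaryGroup_iff.1 hmem

end Evolution

/-! ### Block encoding of the visible state -/

/-- The working qubits: the visible half of the purification, the visible and hidden qubits of the
network, and the purifying register. -/
abbrev WorkQubits (nv nh a : ℕ) : Type := Fin nv ⊕ Fin nv ⊕ Fin nh ⊕ Fin a

section Registers

variable {nv nh a : ℕ}

/-- The register of the purification of `ρ⁻¹ / Tr(ρ⁻¹)`. -/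
def purifReg : Fin nv ⊕ Fin a ↪ WorkQubits nv nh a where
  toFun := Sum.elim Sum.inl (fun i => Sum.inr (Sum.inr (Sum.inr i)))
  inj' := by rintro (i | i) (j | j) h <;> simp_all

/-- The register of the network. -/
def networkReg : Fin nv ⊕ Fin nh ↪ WorkQubits nv nh a where
  toFun := Sum.elim (fun i => Sum.inr (Sum.inl i)) (fun i => Sum.inr (Sum.inr (Sum.inl i)))
  inj' := by rintro (i | i) (j | j) h <;> simp_all

/-- The register of the network with the visible qubits swapped for those of the purification. -/
def swappedReg : Fin nv ⊕ Fin nh ↪ WorkQubits nv nh a where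
  toFun := Sum.elim Sum.inl (fun i => Sum.inr (Sum.inr (Sum.inl i)))
  inj' := by rintro (i | i) (j | j) h <;> simp_all

/-- Prepares a state whose part with zeros on the swapped register is the purification of
`ρ⁻¹ / Tr(ρ⁻¹)`, multiplied by the output of the network `V`. -/
def prepOp (W : Op (Fin nv ⊕ Fin a)) (V : Op (Fin nv ⊕ Fin nh)) :
    Module.End ℂ (Bits (WorkQubits nv nh a) → ℂ) :=
  onReg swappedReg Vᴴ * onReg networkReg V * onReg purifReg W

/-- The inverse of `prepOp`. -/
def unprepOp (W : Op (Fin nv ⊕ Fin a)) (V : Op (Fin nv ⊕ Fin nh)) :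
    Module.End ℂ (Bits (WorkQubits nv nh a) → ℂ) :=
  onReg purifReg Wᴴ * onReg networkReg Vᴴ * onReg swappedReg V

variable {W : Op (Fin nv ⊕ Fin a)} {V : Op (Fin nv ⊕ Fin nh)}

theorem onReg_mul_cancel {R L : Type} [Fintype R] [DecidableEq R] (e : R ↪ L) {U U' : Op R}
    (h : U * U' = 1) (T : Module.End ℂ (Bits L → ℂ)) : onReg e U * (onReg e U' * T) = T := by
  rw [← mul_assoc, ← onReg_mul, h, onReg_one, one_mul]

theorem prepOp_mul_unprepOp (hW : W * Wᴴ = 1) (hV : V * Vᴴ = 1) :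
    prepOp W V * unprepOp W V = 1 := by
  have hV' : Vᴴ * V = 1 := mul_eq_one_comm.1 hV
  simp only [prepOp, unprepOp, mul_assoc]
  rw [onReg_mul_cancel _ hW, onReg_mul_cancel _ hV, ← onReg_mul, hV', onReg_one]

theorem unprepOp_mul_prepOp (hW : W * Wᴴ = 1) (hV : V * Vᴴ = 1) :
    unprepOp W V * prepOp W V = 1 := by
  have hV' : Vᴴ * V = 1 := mul_eq_one_comm.1 hV
  have hW' : Wᴴ * W = 1 := mul_eq_one_comm.1 hW
  simp only [prepOp, unprepOp, mul_assoc]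
  rw [onReg_mul_cancel _ hV, onReg_mul_cancel _ hV', ← onReg_mul, hW', onReg_one]

theorem prepOp_adjoint (φ ψ : Bits (WorkQubits nv nh a) → ℂ) :
    star (prepOp W V φ) ⬝ᵥ ψ = star φ ⬝ᵥ unprepOp W V ψ := by
  simp only [prepOp, unprepOp, Module.End.mul_apply, onReg_adjoint, conjTranspose_conjTranspose]

/-- The qubits that are measured for the success of the block encoding. -/
def swappedQubits (nv nh a : ℕ) : Finset (WorkQubits nv nh a) :=
  Finset.univ.map swappedReg

/-- The basis state with given values on the four registers. -/
def workBits (s v : Bits (Fin nv)) (h : Bits (Fin nh)) (b : Bits (Fin a)) :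
    Bits (WorkQubits nv nh a) :=
  Sum.elim s (Sum.elim v (Sum.elim h b))

theorem sum_workBits {M : Type*} [AddCommMonoid M] (f : Bits (WorkQubits nv nh a) → M) :
    ∑ x, f x = ∑ s, ∑ v, ∑ h, ∑ b, f (workBits s v h b) := by
  rw [← (Equiv.sumArrowEquivProdArrow _ _ Bool).symm.sum_comp, Fintype.sum_prod_type]
  refine Finset.sum_congr rfl fun s _ => ?_
  rw [← (Equiv.sumArrowEquivProdArrow _ _ Bool).symm.sum_comp, Fintype.sum_prod_type]
  refine Finset.sum_congr rfl fun v _ => ?_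
  rw [← (Equiv.sumArrowEquivProdArrow _ _ Bool).symm.sum_comp, Fintype.sum_prod_type]
  rfl

theorem sum_bits_sum {R S : Type} [Fintype R] [DecidableEq R] [Fintype S] [DecidableEq S]
    {M : Type*} [AddCommMonoid M] (f : Bits (R ⊕ S) → M) :
    ∑ x, f x = ∑ r, ∑ s, f (Sum.elim r s) := by
  rw [← (Equiv.sumArrowEquivProdArrow _ _ Bool).symm.sum_comp, Fintype.sum_prod_type]
  rfl

theorem extend_workBits_purif (s v s' : Bits (Fin nv)) (h : Bits (Fin nh)) (b b' : Bits (Fin a)) :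
    Function.extend purifReg (Sum.elim s' b') (workBits s v h b) = workBits s' v h b' := by
  ext w
  rcases w with i | i | i | i
  · exact purifReg.injective.extend_apply _ _ (Sum.inl i)
  · exact Function.extend_apply' _ _ _ (by rintro ⟨j | j, hj⟩ <;> cases hj)
  · exact Function.extend_apply' _ _ _ (by rintro ⟨j | j, hj⟩ <;> cases hj)
  · exact purifReg.injective.extend_apply _ _ (Sum.inr i)

theorem extend_workBits_network (s v v' : Bits (Fin nv)) (h h' : Bits (Fin nh))
    (b : Bits (Fin a)) :
    Function.extend networkReg (Sum.elim v' h') (workBits s v h b) = workBits s v' h' b := by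
  ext w
  rcases w with i | i | i | i
  · exact Function.extend_apply' _ _ _ (by rintro ⟨j | j, hj⟩ <;> cases hj)
  · exact networkReg.injective.extend_apply _ _ (Sum.inl i)
  · exact networkReg.injective.extend_apply _ _ (Sum.inr i)
  · exact Function.extend_apply' _ _ _ (by rintro ⟨j | j, hj⟩ <;> cases hj)

theorem extend_workBits_swapped (s v s' : Bits (Fin nv)) (h h' : Bits (Fin nh))
    (b : Bits (Fin a)) :
    Function.extend swappedReg (Sum.elim s' h') (workBits s v h b) = workBits s' v h' b := by
  ext w
  rcases w with i | i | i | i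
  · exact swappedReg.injective.extend_apply _ _ (Sum.inl i)
  · exact Function.extend_apply' _ _ _ (by rintro ⟨j | j, hj⟩ <;> cases hj)
  · exact swappedReg.injective.extend_apply _ _ (Sum.inr i)
  · exact Function.extend_apply' _ _ _ (by rintro ⟨j | j, hj⟩ <;> cases hj)

theorem workBits_comp_purif (s v : Bits (Fin nv)) (h : Bits (Fin nh)) (b : Bits (Fin a)) :
    workBits s v h b ∘ purifReg = Sum.elim s b := by
  ext (i | i) <;> rfl

theorem workBits_comp_network (s v : Bits (Fin nv)) (h : Bits (Fin nh)) (b : Bits (Fin a)) :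
    workBits s v h b ∘ networkReg = Sum.elim v h := by
  ext (i | i) <;> rfl

theorem workBits_comp_swapped (s v : Bits (Fin nv)) (h : Bits (Fin nh)) (b : Bits (Fin a)) :
    workBits s v h b ∘ swappedReg = Sum.elim s h := by
  ext (i | i) <;> rfl

theorem workBits_eq_zero_iff (s v : Bits (Fin nv)) (h : Bits (Fin nh)) (b : Bits (Fin a)) :
    (workBits s v h b = fun _ => false) ↔
      s = (fun _ => false) ∧ v = (fun _ => false) ∧ h = (fun _ => false) ∧ b = fun _ => false := by
  simp only [funext_iff, workBits, Sum.forall, Sum.elim_inl, Sum.elim_inr]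

theorem mul_zeroProj_mul_apply {R : Type} [Fintype R] [DecidableEq R] (U : Op R) (x y : Bits R) :
    (U * zeroProj R * Uᴴ) x y = U x (fun _ => false) * star (U y (fun _ => false)) := by
  simp only [zeroProj, Matrix.mul_apply, Matrix.single_apply, conjTranspose_apply]
  rw [Finset.sum_eq_single (fun _ => false)]
  · rw [Finset.sum_eq_single (fun _ => false)]
    · simp
    · intro z _ hz; simp [hz.symm]
    · simp
  · intro z _ hz
    simp [hz.symm]
  · simp

/-- The amplitudes of `prepOp W V |0⟩` with zeros on the swapped register. -/
theorem prepOp_apply (v : Bits (Fin nv)) (b : Bits (Fin a)) :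
    prepOp W V (Pi.single (fun _ => false) 1) (workBits (fun _ => false) v (fun _ => false) b) =
      ∑ s, partialTrace (V * zeroProj (Fin nv ⊕ Fin nh) * Vᴴ) v s *
        W (Sum.elim s b) (fun _ => false) := by
  have hz : ∀ {R S : Type}, (Sum.elim (fun _ => false) (fun _ => false) : Bits (R ⊕ S)) =
      fun _ => false := by
    intro R S; ext (i | i) <;> rfl
  have hW : ∀ s v h b, onReg (purifReg (nh := nh)) W (Pi.single (fun _ => false) 1)
      (workBits s v h b) =
      if v = (fun _ => false) ∧ h = (fun _ => false) then W (Sum.elim s b) (fun _ => false)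
      else 0 := by
    intro s v h b
    rw [onReg_apply, sum_bits_sum]
    simp only [extend_workBits_purif, workBits_comp_purif, Pi.single_apply, workBits_eq_zero_iff]
    rw [Finset.sum_eq_single (fun _ => false), Finset.sum_eq_single (fun _ => false)]
    · simp [hz]
    · intro z _ hz'; simp [hz']
    · simp
    · intro z _ hz'; simp [hz']
    · simp
  have hV : ∀ s v h b, onReg networkReg V (onReg (purifReg (nh := nh)) W
      (Pi.single (fun _ => false) 1)) (workBits s v h b) =
      V (Sum.elim v h) (fun _ => false) * W (Sum.elim s b) (fun _ => false) := by
    intro s v h b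
    rw [onReg_apply, sum_bits_sum]
    simp only [extend_workBits_network, workBits_comp_network, hW]
    rw [Finset.sum_eq_single (fun _ => false), Finset.sum_eq_single (fun _ => false)]
    · simp [hz]
    · intro z _ hz'; simp [hz']
    · simp
    · intro z _ hz'; simp [hz']
    · simp
  rw [prepOp, Module.End.mul_apply, Module.End.mul_apply, onReg_apply, sum_bits_sum]
  refine Finset.sum_congr rfl fun s _ => ?_
  rw [partialTrace, Matrix.of_apply, Finset.sum_mul]
  refine Finset.sum_congr rfl fun h _ => ?_
  rw [extend_workBits_swapped, workBits_comp_swapped, hV, hz, mul_zeroProj_mul_apply,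
    conjTranspose_apply]
  ring

theorem partialTrace_isHermitian {S : Type} [Fintype S] [DecidableEq S] {R : Type}
    {A : Op (R ⊕ S)} (hA : A.IsHermitian) : (partialTrace A).IsHermitian := by
  ext x y
  simp only [partialTrace, conjTranspose_apply, Matrix.of_apply, star_sum]
  exact Finset.sum_congr rfl fun z _ => hA.apply _ _

theorem isHermitian_mul_zeroProj {R : Type} [Fintype R] [DecidableEq R] (U : Op R) :
    (U * zeroProj R * Uᴴ).IsHermitian := by
  ext x y
  rw [conjTranspose_apply, mul_zeroProj_mul_apply, mul_zeroProj_mul_apply]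
  simp [mul_comm]

/-- V on one register followed by V† on the swapped one block-encodes σ: tracing the shared hidden
qubits through V and V† produces its matrix elements. The zero component is (σ ⊗ 1)W|0⟩, whose
squared norm is the trace because σ is Hermitian. -/
theorem zeroProb_prepOp :
    zeroProb (swappedQubits nv nh a) (prepOp W V (Pi.single (fun _ => false) 1)) =
      (partialTrace (V * zeroProj (Fin nv ⊕ Fin nh) * Vᴴ) ^ 2 *
        partialTrace (W * zeroProj (Fin nv ⊕ Fin a) * Wᴴ)).trace.re := by
  set σ := partialTrace (V * zeroProj (Fin nv ⊕ Fin nh) * Vᴴ) with hσ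
  have hσh : σ.IsHermitian := partialTrace_isHermitian (isHermitian_mul_zeroProj V)
  have hcond : ∀ (s v : Bits (Fin nv)) (h : Bits (Fin nh)) (b : Bits (Fin a)),
      (∀ p ∈ swappedQubits nv nh a, workBits s v h b p = false) ↔
        s = (fun _ => false) ∧ h = (fun _ => false) := by
    intro s v h b
    simp only [swappedQubits, Finset.forall_mem_map, Finset.mem_univ, forall_true_left, Sum.forall,
      funext_iff]
    rfl
  have hleft : zeroProb (swappedQubits nv nh a) (prepOp W V (Pi.single (fun _ => false) 1)) =
      ∑ v, ∑ b, ‖∑ s, σ v s * W (Sum.elim s b) (fun _ => false)‖ ^ 2 := by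
    rw [zeroProb, sum_workBits, Finset.sum_eq_single (fun _ => false)]
    · refine Finset.sum_congr rfl fun v _ => ?_
      rw [Finset.sum_eq_single (fun _ => false)]
      · refine Finset.sum_congr rfl fun b _ => ?_
        rw [if_pos ((hcond _ _ _ _).2 ⟨rfl, rfl⟩), prepOp_apply]
      · intro h _ hh
        exact Finset.sum_eq_zero fun b _ => if_neg fun h' => hh ((hcond _ _ _ _).1 h').2
      · simp
    · intro s _ hs
      exact Finset.sum_eq_zero fun v _ => Finset.sum_eq_zero fun h _ =>
        Finset.sum_eq_zero fun b _ => if_neg fun h' => hs ((hcond _ _ _ _).1 h').1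
    · simp
  have hright : (σ ^ 2 * partialTrace (W * zeroProj (Fin nv ⊕ Fin a) * Wᴴ)).trace =
      ((∑ v, ∑ b, ‖∑ s, σ v s * W (Sum.elim s b) (fun _ => false)‖ ^ 2 : ℝ) : ℂ) := by
    rw [pow_two, mul_assoc, Matrix.trace_mul_comm, Matrix.trace]
    push_cast
    refine Finset.sum_congr rfl fun v _ => ?_
    have hs : ∀ s, σ s v = (starRingEnd ℂ) (σ v s) := fun s => (hσh.apply s v).symm
    rw [Matrix.diag_apply, Matrix.mul_apply]
    have hl : ∀ s', (σ * partialTrace (W * zeroProj (Fin nv ⊕ Fin a) * Wᴴ)) v s' * σ s' v =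
        ∑ s, σ v s * partialTrace (W * zeroProj (Fin nv ⊕ Fin a) * Wᴴ) s s' *
          (starRingEnd ℂ) (σ v s') := fun s' => by
      rw [Matrix.mul_apply, Finset.sum_mul, hs]
    have hr : ∀ b, ((‖∑ s, σ v s * W (Sum.elim s b) (fun _ => false)‖ : ℝ) : ℂ) ^ 2 =
        ∑ s, ∑ s', (σ v s * W (Sum.elim s b) (fun _ => false)) *
          (starRingEnd ℂ) (σ v s' * W (Sum.elim s' b) (fun _ => false)) := fun b => by
      rw [← Complex.mul_conj', map_sum, Finset.sum_mul_sum]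
    rw [Finset.sum_congr rfl fun s' _ => hl s', Finset.sum_congr rfl fun b _ => hr b,
      Finset.sum_comm, Finset.sum_comm (s := (Finset.univ : Finset (Bits (Fin a))))]
    refine Finset.sum_congr rfl fun s _ => ?_
    rw [Finset.sum_comm (s := (Finset.univ : Finset (Bits (Fin a))))]
    refine Finset.sum_congr rfl fun s' _ => ?_
    simp only [partialTrace, Matrix.of_apply, mul_zeroProj_mul_apply, Finset.mul_sum,
      Finset.sum_mul]
    refine Finset.sum_congr rfl fun b _ => ?_
    rw [Complex.star_def, map_mul]
    ring
  rw [hleft, hright, Complex.ofReal_re]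

end Registers

/-! ### Circuits for the block encoding -/

section Circuits

variable {nv nh a N n : ℕ} {τ : Type}
  (q : WorkQubits nv nh a ⊕ (Fin (indexSize N) ⊕ Fin (indexSize N)) ⊕ τ ≃ Fin n)

/-- The queries that apply `e^{-iH_j t}` for the pairs `(j, t)` of a list. -/
def evolveGates (r : Fin nv ⊕ Fin nh ↪ WorkQubits nv nh a) (l : List (Fin N × ℝ)) :
    Circuit nv nh a N n :=
  l.map fun p => .queryExp p.2 none (indexEmb q (fun i => p.1.1.testBit i) r) (by simp)

variable {W : Op (Fin nv ⊕ Fin a)} {H : Fin N → Op (Fin nv ⊕ Fin nh)}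

/-- The head of a circuit acts first whereas the first factor of a product acts last, hence the
reversal here and in `networkGates`. -/
theorem actsAs_evolveGates (r : Fin nv ⊕ Fin nh ↪ WorkQubits nv nh a) (l : List (Fin N × ℝ)) :
    ActsAs q W H (evolveGates q r l)
      (onReg r ((l.map fun p => evolution (H p.1) p.2).reverse.prod)) := by
  induction l with
  | nil =>
    intro Φ
    simp [evolveGates, Circuit.act_nil, onReg_one]
  | cons p l ih =>
    intro Φ
    have h : (Gate.queryExp p.2 none (indexEmb q (fun i => p.1.1.testBit i) r) (by simp) :
        Gate nv nh a N n).act W H (encode q Φ) =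
        encode q fun y => onReg r (evolution (H p.1) p.2) (Φ y) :=
      applyOn_indexEmb q r (fun j => evolution (H j) p.2) p.1 Φ
    rw [evolveGates, List.map_cons, Circuit.act_cons, h]
    refine (ih _).trans ?_
    simp [onReg_mul]

theorem ActsAs.append {c c' : Circuit nv nh a N n}
    {A A' : Module.End ℂ (Bits (WorkQubits nv nh a) → ℂ)} (hc : ActsAs q W H c A)
    (hc' : ActsAs q W H c' A') : ActsAs q W H (c ++ c') (A' * A) := by
  intro Φ
  rw [Circuit.act_append, hc, hc']
  rfl

/-- The queries of the network. -/
def networkGates (r : Fin nv ⊕ Fin nh ↪ WorkQubits nv nh a) (θ : Fin N → ℝ) :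
    Circuit nv nh a N n :=
  evolveGates q r (List.ofFn fun j => (j, θ j)).reverse

/-- The queries of the inverse of the network. -/
def networkInvGates (r : Fin nv ⊕ Fin nh ↪ WorkQubits nv nh a) (θ : Fin N → ℝ) :
    Circuit nv nh a N n :=
  evolveGates q r (List.ofFn fun j => (j, -θ j))

theorem actsAs_networkGates (r : Fin nv ⊕ Fin nh ↪ WorkQubits nv nh a) (θ : Fin N → ℝ) :
    ActsAs q W H (networkGates q r θ) (onReg r (network H θ)) := by
  have h := actsAs_evolveGates q (W := W) (H := H) r (List.ofFn fun j => (j, θ j)).reverse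
  rwa [← List.map_reverse, List.reverse_reverse, List.map_ofFn] at h

theorem actsAs_networkInvGates (hH : ∀ j, H j * H j = 1) (hherm : ∀ j, (H j).IsHermitian)
    (r : Fin nv ⊕ Fin nh ↪ WorkQubits nv nh a) (θ : Fin N → ℝ) :
    ActsAs q W H (networkInvGates q r θ) (onReg r (network H θ)ᴴ) := by
  have h := actsAs_evolveGates q (W := W) (H := H) r (List.ofFn fun j => (j, -θ j))
  have h2 : (network H θ)ᴴ =
      ((List.ofFn fun j => (j, -θ j)).map fun p => evolution (H p.1) p.2).reverse.prod := by
    rw [network, Matrix.conjTranspose_list_prod, List.map_ofFn, List.map_ofFn]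
    congr 3
    ext1 j
    exact (evolution_neg (hH j) (hherm j) (θ j)).symm
  rwa [← h2] at h

/-- A query to the preparation oracle. -/
def prepQuery (inverse : Bool) : Circuit nv nh a N n :=
  [.queryPrep inverse none (workEmb q purifReg) (by simp)]

theorem actsAs_prepQuery (inverse : Bool) :
    ActsAs q W H (prepQuery q inverse) (onReg purifReg (if inverse then Wᴴ else W)) := fun Φ =>
  applyOn_workEmb q purifReg (if inverse then Wᴴ else W) Φ

/-- The circuit of `prepOp`. -/
def prepCircuit (θ : Fin N → ℝ) : Circuit nv nh a N n :=
  prepQuery q false ++ networkGates q networkReg θ ++ networkInvGates q swappedReg θ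

/-- The circuit of `unprepOp`. -/
def unprepCircuit (θ : Fin N → ℝ) : Circuit nv nh a N n :=
  networkGates q swappedReg θ ++ networkInvGates q networkReg θ ++ prepQuery q true

theorem actsAs_prepCircuit (hH : ∀ j, H j * H j = 1) (hherm : ∀ j, (H j).IsHermitian)
    (θ : Fin N → ℝ) : ActsAs q W H (prepCircuit q θ) (prepOp W (network H θ)) := by
  have h := ((actsAs_prepQuery q (W := W) (H := H) false).append q
    (actsAs_networkGates q networkReg θ)).append q
    (actsAs_networkInvGates q hH hherm swappedReg θ)
  simpa [prepOp, prepCircuit, mul_assoc] using h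

theorem actsAs_unprepCircuit (hH : ∀ j, H j * H j = 1) (hherm : ∀ j, (H j).IsHermitian)
    (θ : Fin N → ℝ) : ActsAs q W H (unprepCircuit q θ) (unprepOp W (network H θ)) := by
  have h := ((actsAs_networkGates q (W := W) (H := H) swappedReg θ).append q
    (actsAs_networkInvGates q hH hherm networkReg θ)).append q
    (actsAs_prepQuery q true)
  simpa [unprepOp, unprepCircuit, mul_assoc] using h

theorem cost_prepCircuit (θ : Fin N → ℝ) :
    (prepCircuit q θ : Circuit nv nh a N n).cost = 2 * N + 1 := by
  simp [Circuit.cost, prepCircuit, networkGates, networkInvGates, evolveGates, prepQuery,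
    Gate.cost, Function.comp_def]
  ring

theorem cost_unprepCircuit (θ : Fin N → ℝ) :
    (unprepCircuit q θ : Circuit nv nh a N n).cost = 2 * N + 1 := by
  simp [Circuit.cost, unprepCircuit, networkGates, networkInvGates, evolveGates, prepQuery,
    Gate.cost, Function.comp_def]
  ring

theorem reflections_prepCircuit (θ : Fin N → ℝ) :
    (prepCircuit q θ : Circuit nv nh a N n).reflections = 0 := by
  simp [Circuit.reflections, prepCircuit, networkGates, networkInvGates, evolveGates, prepQuery,
    Gate.reflections, Function.comp_def]

theorem reflections_unprepCircuit (θ : Fin N → ℝ) :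
    (unprepCircuit q θ : Circuit nv nh a N n).reflections = 0 := by
  simp [Circuit.reflections, unprepCircuit, networkGates, networkInvGates, evolveGates, prepQuery,
    Gate.reflections, Function.comp_def]

theorem reflectionSize_prepCircuit (θ : Fin N → ℝ) :
    (prepCircuit q θ : Circuit nv nh a N n).reflectionSize = 0 := by
  simp [Circuit.reflectionSize, prepCircuit, networkGates, networkInvGates, evolveGates, prepQuery,
    Gate.reflectionSize, Function.comp_def]

theorem reflectionSize_unprepCircuit (θ : Fin N → ℝ) :
    (unprepCircuit q θ : Circuit nv nh a N n).reflectionSize = 0 := by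
  simp [Circuit.reflectionSize, unprepCircuit, networkGates, networkInvGates, evolveGates,
    prepQuery, Gate.reflectionSize, Function.comp_def]

end Circuits

/-! ### Estimation of a single value -/

/-- Estimation of the square root of `Tr(σ² ρ⁻¹) / Tr(ρ⁻¹)`. -/
theorem exists_sqrt_estimation (nv nh a N : ℕ) (hN : 0 < N) (θ : Fin N → ℝ) (J : ℕ) :
    ∃ (n : ℕ) (c : Circuit nv nh a N n) (estimate : Bits (Fin n) → ℝ),
      c.cost ≤ 60000 * 4 ^ J * N ∧ c.reflections ≤ 8192 * 4 ^ J ∧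
      c.reflectionSize ≤ 8192 * 4 ^ J * (2 * nv + nh + a + 1) ∧
      ∀ (ρ : Op (Fin nv)) (H : Fin N → Op (Fin nv ⊕ Fin nh)) (W : Op (Fin nv ⊕ Fin a)),
        (∀ j, (H j).IsHermitian ∧ H j ∈ Matrix.unitaryGroup (Bits (Fin nv ⊕ Fin nh)) ℂ) →
        PreparesInverse W ρ →
        0 ≤ (visibleState H θ ^ 2 * normalizedInverse ρ).trace.re ∧
        (visibleState H θ ^ 2 * normalizedInverse ρ).trace.re ≤ 1 ∧
        15 / 16 ≤ c.prob W H {x | |estimate x -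
          √(visibleState H θ ^ 2 * normalizedInverse ρ).trace.re| ≤ 1 / 4 ^ J} := by
  set q := Fintype.equivFin
    (WorkQubits nv nh a ⊕ (Fin (indexSize N) ⊕ Fin (indexSize N)) ⊕ Test J)
  refine ⟨_, amplitudeCircuit q (prepCircuit q θ) (unprepCircuit q θ) (swappedQubits nv nh a),
    fun x => estimateAmplitude (fun t => x (q (Sum.inr (Sum.inr t)))), ?_, ?_, ?_, ?_⟩
  · refine (cost_amplitudeCircuit_le q _ _ _ (cost_prepCircuit q θ).le
      (cost_unprepCircuit q θ).le).trans ?_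
    rw [Fintype.card_fin]
    -- The initial flips fit into the cost O(N). With K = 2N + 1 the main term is 4096 · 4^J · (4N +
    -- 5), at most 36864 · 4^J · N; the constant 60000 covers the rest.
    have h1 : indexSize N ≤ N := Nat.clog_le_of_le_pow (Nat.lt_two_pow_self).le
    have h2 : 1 ≤ 4 ^ J := Nat.one_le_pow _ _ (by norm_num)
    have h3 : N ≤ 4 ^ J * N := Nat.le_mul_of_pos_left _ h2
    have h4 : 4 ^ J ≤ 4 ^ J * N := Nat.le_mul_of_pos_right _ hN
    nlinarith
  · exact reflections_amplitudeCircuit_le q _ _ _ (reflections_prepCircuit q θ)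
      (reflections_unprepCircuit q θ)
  · refine (reflectionSize_amplitudeCircuit_le q _ _ _ (reflectionSize_prepCircuit q θ)
      (reflectionSize_unprepCircuit q θ)).trans (le_of_eq ?_)
    simp only [Fintype.card_sum, Fintype.card_fin]
    ring
  · intro ρ H W hHj hW
    have hherm := fun j => (hHj j).1
    have hH : ∀ j, H j * H j = 1 := fun j => by
      have := Matrix.mem_unitaryGroup_iff.1 (hHj j).2
      rwa [star_eq_conjTranspose, (hHj j).1] at this
    have hV := network_mul_conjTranspose hH hherm θ
    have hWW : W * Wᴴ = 1 := Matrix.mem_unitaryGroup_iff.1 hW.1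
    have hzero := zeroProb_prepOp (W := W) (V := network H θ)
    rw [hW.2] at hzero
    have hAA := unprepOp_mul_prepOp hWW hV
    have hAA' := prepOp_mul_unprepOp hWW hV
    have hψ : star (prepOp W (network H θ) (Pi.single (fun _ => false) 1)) ⬝ᵥ
        prepOp W (network H θ) (Pi.single (fun _ => false) 1) = 1 := by
      rw [prepOp_adjoint, ← Module.End.mul_apply, hAA]
      simp [dotProduct, Pi.single_apply]
    unfold visibleState outputState
    rw [← hzero]
    exact ⟨zeroProb_nonneg _ _, zeroProb_le_one _ _ hψ,
      amplitudeCircuit_prob q (actsAs_prepCircuit q hH hherm θ)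
      (actsAs_unprepCircuit q hH hherm θ) hAA hAA' prepOp_adjoint _⟩

/-! ### Circuits side by side on disjoint qubits -/

section Parallel

variable {nv nh a N n n' : ℕ}

theorem notMem_range_trans {R : Type} (ι : Fin n ↪ Fin n') {ctrl : Option (Fin n)}
    {e : R ↪ Fin n} (hc : ∀ c ∈ ctrl, c ∉ Set.range e) :
    ∀ c ∈ ctrl.map ι, c ∉ Set.range (e.trans ι) := by
  rintro c hcm ⟨r, rfl⟩
  obtain ⟨d, hd, hd'⟩ := Option.map_eq_some_iff.1 hcm
  exact hc d hd ⟨r, (ι.injective hd').symm⟩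

/-- A gate with its qubits relabelled. -/
def Gate.relabel (ι : Fin n ↪ Fin n') : Gate nv nh a N n → Gate nv nh a N n'
  | .single q U hU => .single (ι q) U hU
  | .toffoli c₁ c₂ t h₁₂ h₁ h₂ =>
      .toffoli (ι c₁) (ι c₂) (ι t) (ι.injective.ne h₁₂) (ι.injective.ne h₁) (ι.injective.ne h₂)
  | .reflection S => .reflection (S.map ι)
  | .queryPrep inverse ctrl e hc =>
      .queryPrep inverse (ctrl.map ι) (e.trans ι) (notMem_range_trans ι hc)
  | .queryHam ctrl e hc => .queryHam (ctrl.map ι) (e.trans ι) (notMem_range_trans ι hc)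
  | .queryExp t ctrl e hc => .queryExp t (ctrl.map ι) (e.trans ι) (notMem_range_trans ι hc)

/-- The product of a state on the qubits in the image of `ι` with spectator amplitudes `K`. -/
def withSpectators (ι : Fin n ↪ Fin n') (F : Ket n) (K : Ket n') : Ket n' :=
  fun x => F (x ∘ ι) * K x

variable {ι : Fin n ↪ Fin n'} {K : Ket n'}
  (hK : ∀ x x' : Bits (Fin n'), (∀ p, p ∉ Set.range ι → x p = x' p) → K x = K x')

include hK in
theorem applyOn_withSpectators {R : Type} [Fintype R] [DecidableEq R] (e : R ↪ Fin n) (U : Op R)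
    (F : Ket n) :
    applyOn (e.trans ι) U (withSpectators ι F K) = withSpectators ι (applyOn e U F) K := by
  ext x
  simp only [applyOn, withSpectators, Finset.sum_mul]
  refine Finset.sum_congr rfl fun y _ => ?_
  have h1 : Function.extend (e.trans ι) y x ∘ ι = Function.extend e y (x ∘ ι) := by
    ext p
    by_cases h : ∃ r, e r = p
    · obtain ⟨r, rfl⟩ := h
      rw [e.injective.extend_apply]
      exact (e.trans ι).injective.extend_apply _ _ r
    · rw [Function.extend_apply' _ _ _ h, Function.comp_apply, Function.extend_apply']
      · rfl
      · simpa using h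
  have h2 : K (Function.extend (e.trans ι) y x) = K x := by
    refine hK _ _ fun p hp => Function.extend_apply' _ _ _ ?_
    rintro ⟨r, rfl⟩
    exact hp ⟨e r, rfl⟩
  rw [h1, h2, mul_assoc]
  rfl

include hK in
theorem applyCtrl_withSpectators {R : Type} [Fintype R] [DecidableEq R] (ctrl : Option (Fin n))
    (e : R ↪ Fin n) (U : Op R) (F : Ket n) :
    applyCtrl (ctrl.map ι) (e.trans ι) U (withSpectators ι F K) =
      withSpectators ι (applyCtrl ctrl e U F) K := by
  cases ctrl with
  | none => exact applyOn_withSpectators hK e U F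
  | some c =>
    have h := applyOn_withSpectators hK e U F
    ext x
    simp only [Option.map_some, applyCtrl, h, withSpectators, Function.comp_apply]
    split_ifs <;> rfl

-- A relabelled gate only touches qubits in the image of ι, on which the spectator factor `K` does
-- not depend, so the product form survives every gate.
include hK in
theorem act_relabel (W : Op (Fin nv ⊕ Fin a)) (H : Fin N → Op (Fin nv ⊕ Fin nh))
    (g : Gate nv nh a N n) (F : Ket n) :
    (g.relabel ι).act W H (withSpectators ι F K) = withSpectators ι (g.act W H F) K := by
  have hup : ∀ (x : Bits (Fin n')) q b,
      Function.update x (ι q) b ∘ ι = Function.update (x ∘ ι) q b := fun x q b => by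
    ext p
    by_cases h : p = q
    · subst h; simp
    · simp [Function.update_of_ne h, Function.update_of_ne (ι.injective.ne h)]
  have hKup : ∀ x q b, K (Function.update x (ι q) b) = K x := fun x q b =>
    hK _ _ fun p hp => Function.update_of_ne (by rintro rfl; exact hp ⟨q, rfl⟩) _ _
  cases g with
  | single q U hU =>
    ext x
    simp only [Gate.relabel, Gate.act, withSpectators, hup, hKup, Finset.sum_mul]
    exact Finset.sum_congr rfl fun b _ => (mul_assoc _ _ _).symm
  | toffoli c₁ c₂ t _ _ _ =>
    ext x
    simp only [Gate.relabel, Gate.act, withSpectators, Function.comp_apply]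
    split_ifs
    · rw [hup, hKup]
    · rfl
  | reflection S =>
    ext x
    simp only [Gate.relabel, Gate.act, withSpectators, Finset.forall_mem_map, Function.comp_apply]
    split_ifs <;> simp
  | queryPrep inverse ctrl e hc => exact applyCtrl_withSpectators hK ctrl e _ F
  | queryHam ctrl e hc => exact applyCtrl_withSpectators hK ctrl e _ F
  | queryExp t ctrl e hc => exact applyCtrl_withSpectators hK ctrl e _ F

include hK in
theorem act_map_relabel (W : Op (Fin nv ⊕ Fin a)) (H : Fin N → Op (Fin nv ⊕ Fin nh))
    (c : Circuit nv nh a N n) (F : Ket n) :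
    Circuit.act (c.map (Gate.relabel ι)) W H (withSpectators ι F K) =
      withSpectators ι (Circuit.act c W H F) K := by
  induction c generalizing F with
  | nil => rfl
  | cons g c ih =>
    rw [List.map_cons, Circuit.act_cons, act_relabel hK, ih, Circuit.act_cons]

/-- Two circuits side by side. -/
def parallel (c : Circuit nv nh a N n) (d : Circuit nv nh a N n') : Circuit nv nh a N (n + n') :=
  c.map (Gate.relabel (Fin.castAddEmb n')) ++ d.map (Gate.relabel (Fin.natAddEmb n))

/-- First the initial state of the second block is the spectator, then the output of the first block
is. -/
theorem run_parallel (W : Op (Fin nv ⊕ Fin a)) (H : Fin N → Op (Fin nv ⊕ Fin nh))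
    (c : Circuit nv nh a N n) (d : Circuit nv nh a N n') (x : Bits (Fin (n + n'))) :
    (parallel c d).run W H x =
      c.run W H (x ∘ Fin.castAddEmb n') * d.run W H (x ∘ Fin.natAddEmb n) := by
  have hinit : (Pi.single (fun _ => false) 1 : Ket (n + n')) =
      withSpectators (Fin.castAddEmb n') (Pi.single (fun _ => false) 1)
        (fun x => (Pi.single (fun _ => false) 1 : Ket n') (x ∘ Fin.natAddEmb n)) := by
    ext x
    simp only [withSpectators, Pi.single_apply, ite_mul, one_mul, zero_mul, ← ite_and]
    congr 1
    simp only [eq_iff_iff, funext_iff, Function.comp_apply]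
    refine ⟨fun h => ⟨fun i => h _, fun i => h _⟩, fun h i => ?_⟩
    induction i using Fin.addCases with
    | left i => exact h.1 i
    | right i => exact h.2 i
  have hswap : ∀ (F : Ket n) (G : Ket n'), withSpectators (Fin.castAddEmb n') F
      (fun x => G (x ∘ Fin.natAddEmb n)) = withSpectators (Fin.natAddEmb n) G
      (fun x => F (x ∘ Fin.castAddEmb n')) := fun F G => by
    ext x; exact mul_comm _ _
  have hne : ∀ (i : Fin n) (j : Fin n'), Fin.castAddEmb n' i ≠ Fin.natAddEmb n j := by
    intro i j h
    have := congrArg Fin.val h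
    simp at this
    omega
  rw [Circuit.run_eq, parallel, Circuit.act_append, hinit, act_map_relabel, hswap,
    act_map_relabel]
  · exact mul_comm _ _
  · intro x x' h
    congr 1
    ext i
    exact h _ (by rintro ⟨j, hj⟩; exact hne _ _ hj.symm)
  · intro x x' h
    congr 1
    ext i
    exact h _ (by rintro ⟨j, hj⟩; exact hne _ _ hj)

theorem prob_parallel (W : Op (Fin nv ⊕ Fin a)) (H : Fin N → Op (Fin nv ⊕ Fin nh))
    (c : Circuit nv nh a N n) (d : Circuit nv nh a N n') (E : Set (Bits (Fin n)))
    (E' : Set (Bits (Fin n'))) :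
    (parallel c d).prob W H {x | x ∘ Fin.castAddEmb n' ∈ E ∧ x ∘ Fin.natAddEmb n ∈ E'} =
      c.prob W H E * d.prob W H E' := by
  classical
  unfold Circuit.prob
  rw [Finset.sum_mul_sum, ← Fintype.sum_prod_type', ← (Fin.appendEquiv n n').sum_comp]
  refine Finset.sum_congr rfl fun p _ => ?_
  have h1 : Fin.appendEquiv n n' p ∘ Fin.castAddEmb n' = p.1 := by
    exact funext fun i => Fin.append_left p.1 p.2 i
  have h2 : Fin.appendEquiv n n' p ∘ Fin.natAddEmb n = p.2 := by
    exact funext fun i => Fin.append_right p.1 p.2 i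
  rw [run_parallel, h1, h2]
  simp only [Set.mem_ofPred_eq, h1, h2]
  by_cases hE : p.1 ∈ E <;> by_cases hE' : p.2 ∈ E' <;> simp [hE, hE', mul_pow]

theorem prob_mono (W : Op (Fin nv ⊕ Fin a)) (H : Fin N → Op (Fin nv ⊕ Fin nh))
    (c : Circuit nv nh a N n) {E E' : Set (Bits (Fin n))} (h : E ⊆ E') :
    c.prob W H E ≤ c.prob W H E' := by
  classical
  unfold Circuit.prob
  refine Finset.sum_le_sum fun x _ => ?_
  by_cases hx : x ∈ E
  · rw [if_pos hx, if_pos (h hx)]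
  · rw [if_neg hx]
    split_ifs <;> positivity

theorem cost_parallel (c : Circuit nv nh a N n) (d : Circuit nv nh a N n') :
    (parallel c d).cost = c.cost + d.cost := by
  have h : ∀ {m m' : ℕ} (ι : Fin m ↪ Fin m'),
      (Gate.cost ∘ Gate.relabel ι : Gate nv nh a N m → ℕ) = Gate.cost := fun ι => by
    ext g; cases g <;> rfl
  simp [Circuit.cost, parallel, h]

theorem reflections_parallel (c : Circuit nv nh a N n) (d : Circuit nv nh a N n') :
    (parallel c d).reflections = c.reflections + d.reflections := by
  have h : ∀ {m m' : ℕ} (ι : Fin m ↪ Fin m'),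
      (Gate.reflections ∘ Gate.relabel ι : Gate nv nh a N m → ℕ) = Gate.reflections := fun ι => by
    ext g; cases g <;> rfl
  simp [Circuit.reflections, parallel, h]

theorem reflectionSize_parallel (c : Circuit nv nh a N n) (d : Circuit nv nh a N n') :
    (parallel c d).reflectionSize = c.reflectionSize + d.reflectionSize := by
  have h : ∀ {m m' : ℕ} (ι : Fin m ↪ Fin m'),
      (Gate.reflectionSize ∘ Gate.relabel ι : Gate nv nh a N m → ℕ) = Gate.reflectionSize :=
    fun ι => by
      ext g; cases g <;> simp [Gate.relabel, Gate.reflectionSize]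
  simp [Circuit.reflectionSize, parallel, h]

end Parallel

/-- Simultaneous estimation of the square roots of `Tr(σ² ρ⁻¹) / Tr(ρ⁻¹)` for several choices of
the parameters of the network. -/
theorem exists_sqrt_estimations (nv nh a N : ℕ) (hN : 0 < N) (J m : ℕ)
    (θ : Fin m → Fin N → ℝ) :
    ∃ (n : ℕ) (c : Circuit nv nh a N n) (estimate : Bits (Fin n) → Fin m → ℝ),
      c.cost ≤ m * (60000 * 4 ^ J * N) ∧ c.reflections ≤ m * (8192 * 4 ^ J) ∧
      c.reflectionSize ≤ m * (8192 * 4 ^ J * (2 * nv + nh + a + 1)) ∧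
      ∀ (ρ : Op (Fin nv)) (H : Fin N → Op (Fin nv ⊕ Fin nh)) (W : Op (Fin nv ⊕ Fin a)),
        (∀ j, (H j).IsHermitian ∧ H j ∈ Matrix.unitaryGroup (Bits (Fin nv ⊕ Fin nh)) ℂ) →
        PreparesInverse W ρ →
        (15 / 16) ^ m ≤ c.prob W H {x | ∀ i, |estimate x i -
          √(visibleState H (θ i) ^ 2 * normalizedInverse ρ).trace.re| ≤ 1 / 4 ^ J} := by
  induction m with
  | zero =>
    refine ⟨0, [], fun _ => Fin.elim0, by simp [Circuit.cost], by simp [Circuit.reflections],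
      by simp [Circuit.reflectionSize], fun ρ H W _ _ => ?_⟩
    simp [Circuit.prob, Circuit.run, Subsingleton.elim _ (fun _ : Fin 0 => false)]
  | succ m ih =>
    obtain ⟨n, c, est, h1, h2, h3, h4⟩ := ih (fun i => θ i.succ)
    obtain ⟨n', d, est', h1', h2', h3', h4'⟩ := exists_sqrt_estimation nv nh a N hN (θ 0) J
    refine ⟨n + n', parallel c d, fun x => Fin.cons (est' (x ∘ Fin.natAddEmb n))
      (est (x ∘ Fin.castAddEmb n')), ?_, ?_, ?_, fun ρ H W hH hW => ?_⟩
    · rw [cost_parallel, add_mul, one_mul]; omega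
    · rw [reflections_parallel, add_mul, one_mul]; omega
    · rw [reflectionSize_parallel, add_mul, one_mul]; omega
    · have e1 := h4 ρ H W hH hW
      have e2 := (h4' ρ H W hH hW).2.2
      calc ((15 : ℝ) / 16) ^ (m + 1) = (15 / 16) ^ m * (15 / 16) := pow_succ _ _
        _ ≤ _ := mul_le_mul e1 e2 (by norm_num) (le_trans (by positivity) e1)
        _ = _ := (prob_parallel W H c d _ _).symm
        _ ≤ _ := by
          refine prob_mono W H _ ?_
          rintro x ⟨hx, hx'⟩ i
          induction i using Fin.cases with
          | zero => exact hx'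
          | succ i => exact hx i

/-! ### Dependence of the visible state on one parameter -/

section Output

variable {nv nh N : ℕ} {H : Fin N → Op (Fin nv ⊕ Fin nh)}

/-- Isolates the single factor of the network that depends on θ_k, between two constant matrices. -/
theorem exists_prod_ofFn_update {M : Type*} [Monoid M] {N : ℕ} (f : Fin N → M) (k : Fin N) :
    ∃ L R : M, ∀ u, (List.ofFn (Function.update f k u)).prod = L * u * R := by
  induction N with
  | zero => exact k.elim0
  | succ N ih =>
    induction k using Fin.cases with
    | zero =>
      refine ⟨1, (List.ofFn fun j => f j.succ).prod, fun u => ?_⟩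
      simp [List.ofFn_succ]
    | succ k =>
      obtain ⟨L, R, h⟩ := ih (fun j => f j.succ) k
      refine ⟨f 0 * L, R, fun u => ?_⟩
      have htail : (fun j : Fin N => Function.update f k.succ u j.succ) =
          Function.update (fun j => f j.succ) k u := by
        ext j
        by_cases hj : j = k
        · subst hj; simp
        · rw [Function.update_of_ne hj, Function.update_of_ne (by simpa using hj)]
      rw [List.ofFn_succ, List.prod_cons, htail, h,
        Function.update_of_ne (Fin.succ_ne_zero k).symm]
      simp only [mul_assoc]

theorem partialTrace_add {R S : Type} [Fintype S] [DecidableEq S] (A B : Op (R ⊕ S)) :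
    partialTrace (A + B) = partialTrace A + partialTrace B := by
  ext x y
  simp [partialTrace, Finset.sum_add_distrib]

theorem partialTrace_smul {R S : Type} [Fintype S] [DecidableEq S] (c : ℂ) (A : Op (R ⊕ S)) :
    partialTrace (c • A) = c • partialTrace A := by
  ext x y
  simp [partialTrace, Finset.mul_sum]

theorem trace_partialTrace {R S : Type} [Fintype R] [DecidableEq R] [Fintype S] [DecidableEq S]
    (A : Op (R ⊕ S)) : (partialTrace A).trace = A.trace := by
  simp only [Matrix.trace, Matrix.diag_apply, partialTrace, Matrix.of_apply]
  rw [sum_bits_sum]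

theorem visibleState_isHermitian (θ : Fin N → ℝ) : (visibleState H θ).IsHermitian :=
  partialTrace_isHermitian (isHermitian_mul_zeroProj _)

theorem trace_visibleState (hH : ∀ j, H j * H j = 1) (hherm : ∀ j, (H j).IsHermitian)
    (θ : Fin N → ℝ) : (visibleState H θ).trace = 1 := by
  rw [visibleState, trace_partialTrace, outputState, Matrix.trace_mul_comm, ← mul_assoc,
    mul_eq_one_comm.1 (network_mul_conjTranspose hH hherm θ), one_mul, zeroProj,
    Matrix.trace_single_eq_same]

/-- The output of the network is a trigonometric polynomial in each parameter. -/
theorem exists_visibleState_trig (hH : ∀ j, H j * H j = 1) (θ : Fin N → ℝ) (k : Fin N) :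
    ∃ S₀ S₁ S₂ : Op (Fin nv), ∀ x : ℝ, visibleState H (Function.update θ k x) =
      S₀ + (Real.cos (2 * x) : ℂ) • S₁ + (Real.sin (2 * x) : ℂ) • S₂ := by
  obtain ⟨L, R, hLR⟩ := exists_prod_ofFn_update (fun j => evolution (H j) (θ j)) k
  set M₀ := L * R with hM₀
  set M₁ := -(Complex.I • (L * H k * R)) with hM₁
  have hnet : ∀ x : ℝ, network H (Function.update θ k x) =
      (Real.cos x : ℂ) • M₀ + (Real.sin x : ℂ) • M₁ := by
    intro x
    have : (fun j => evolution (H j) (Function.update θ k x j)) =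
        Function.update (fun j => evolution (H j) (θ j)) k (evolution (H k) x) := by
      ext1 j
      by_cases hj : j = k
      · subst hj; simp
      · rw [Function.update_of_ne hj, Function.update_of_ne hj]
    rw [network, this, hLR, evolution_eq (hH k)]
    simp only [mul_sub, sub_mul, mul_smul_comm, smul_mul_assoc, mul_one, hM₀, hM₁]
    module
  set Z := zeroProj (Fin nv ⊕ Fin nh)
  -- The network is linear in cos x and sin x, so the state is quadratic in them; cos² = (1 + cos
  -- 2x)/2, sin² = (1 − cos 2x)/2 and sin x cos x = (sin 2x)/2 give these coefficients.
  refine ⟨(1 / 2 : ℂ) • (partialTrace (M₀ * Z * M₀ᴴ) + partialTrace (M₁ * Z * M₁ᴴ)),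
    (1 / 2 : ℂ) • (partialTrace (M₀ * Z * M₀ᴴ) + (-1 : ℂ) • partialTrace (M₁ * Z * M₁ᴴ)),
    (1 / 2 : ℂ) • (partialTrace (M₀ * Z * M₁ᴴ) + partialTrace (M₁ * Z * M₀ᴴ)), fun x => ?_⟩
  have hc : (Real.cos (2 * x) : ℂ) = 2 * (Real.cos x : ℂ) ^ 2 - 1 := by
    rw [Real.cos_two_mul]; push_cast; ring
  have hs : (Real.sin (2 * x) : ℂ) = 2 * (Real.sin x : ℂ) * (Real.cos x : ℂ) := by
    rw [Real.sin_two_mul]; push_cast; ring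
  have hsc : (Real.sin x : ℂ) ^ 2 = 1 - (Real.cos x : ℂ) ^ 2 := by
    rw [← Complex.ofReal_pow, Real.sin_sq]; push_cast; ring
  have hout : outputState H (Function.update θ k x) =
      ((Real.cos x : ℂ) ^ 2) • (M₀ * Z * M₀ᴴ) + ((Real.sin x : ℂ) ^ 2) • (M₁ * Z * M₁ᴴ) +
        ((Real.sin x : ℂ) * (Real.cos x : ℂ)) • (M₀ * Z * M₁ᴴ + M₁ * Z * M₀ᴴ) := by
    rw [outputState, hnet]
    simp only [conjTranspose_add, conjTranspose_smul, Complex.star_def, Complex.conj_ofReal,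
      add_mul, mul_add, smul_mul_assoc, mul_smul_comm]
    module
  rw [visibleState, hout]
  simp only [partialTrace_add, partialTrace_smul, hc, hs, hsc]
  module

end Output

/-! ### The trace form, its Cauchy-Schwarz inequality and the parameter-shift rule -/

section Quadratic

variable {R : Type} [Fintype R] [DecidableEq R]

/-- The bilinear form `Re Tr(X Y P)`. -/
def traceForm (P X Y : Op R) : ℝ := (X * Y * P).trace.re

theorem traceForm_add_left (P X X' Y : Op R) :
    traceForm P (X + X') Y = traceForm P X Y + traceForm P X' Y := by
  simp [traceForm, add_mul]

theorem traceForm_add_right (P X Y Y' : Op R) :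
    traceForm P X (Y + Y') = traceForm P X Y + traceForm P X Y' := by
  simp [traceForm, add_mul, mul_add]

theorem traceForm_smul_left (P X Y : Op R) (c : ℝ) :
    traceForm P ((c : ℂ) • X) Y = c * traceForm P X Y := by
  simp [traceForm]

theorem traceForm_smul_right (P X Y : Op R) (c : ℝ) :
    traceForm P X ((c : ℂ) • Y) = c * traceForm P X Y := by
  simp [traceForm]

theorem traceForm_self_nonneg {P X : Op R} (hP : P.PosSemidef) (hX : X.IsHermitian) :
    0 ≤ traceForm P X X := by
  have h := (hP.conjTranspose_mul_mul_same X).trace_nonneg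
  rw [hX.eq, mul_assoc, ← Matrix.trace_mul_comm] at h
  have h2 : (X * X * P).trace = (P * X * X).trace := by
    rw [Matrix.trace_mul_comm, mul_assoc]
  rw [traceForm, h2]
  exact (Complex.le_def.1 h).1

/-- Cauchy-Schwarz for the trace form. -/
theorem traceForm_sq_le {P X Y : Op R} (hP : P.PosSemidef) (hX : X.IsHermitian)
    (hY : Y.IsHermitian) :
    (traceForm P X Y + traceForm P Y X) ^ 2 ≤ 4 * traceForm P X X * traceForm P Y Y := by
  have h : ∀ t : ℝ, 0 ≤ traceForm P Y Y * (t * t) +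
      (traceForm P X Y + traceForm P Y X) * t + traceForm P X X := by
    intro t
    have hXY : (X + (t : ℂ) • Y).IsHermitian := by
      refine hX.add ?_
      rw [Matrix.IsHermitian, conjTranspose_smul, hY.eq]
      simp
    have h := traceForm_self_nonneg hP hXY
    simp only [traceForm_add_left, traceForm_add_right, traceForm_smul_left,
      traceForm_smul_right] at h
    linarith
  have := discrim_le_zero h
  rw [discrim] at this
  linarith

end Quadratic

/-- A trigonometric polynomial `Q(σ(x), σ(x))` with `σ(x) = S₀ + cos(2x) S₁ + sin(2x) S₂`. -/
theorem hasDerivAt_traceForm {R : Type} [Fintype R] [DecidableEq R] (P S₀ S₁ S₂ : Op R)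
    (σ : ℝ → Op R)
    (hσ : ∀ x, σ x = S₀ + (Real.cos (2 * x) : ℂ) • S₁ + (Real.sin (2 * x) : ℂ) • S₂) (x : ℝ) :
    ∃ A : ℝ, HasDerivAt (fun x => traceForm P (σ x) (σ x)) A x ∧
      A = traceForm P (σ x) (σ (x + Real.pi / 4) - σ (x - Real.pi / 4)) +
        traceForm P (σ (x + Real.pi / 4) - σ (x - Real.pi / 4)) (σ x) ∧
      A = (1 - √2) * (traceForm P (σ (x + Real.pi / 4)) (σ (x + Real.pi / 4)) -
          traceForm P (σ (x - Real.pi / 4)) (σ (x - Real.pi / 4))) +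
        2 * (traceForm P (σ (x + Real.pi / 8)) (σ (x + Real.pi / 8)) -
          traceForm P (σ (x - Real.pi / 8)) (σ (x - Real.pi / 8))) := by
  have hB : ∀ x, traceForm P (σ x) (σ x) = traceForm P S₀ S₀ +
      Real.cos (2 * x) * (traceForm P S₀ S₁ + traceForm P S₁ S₀) +
      Real.sin (2 * x) * (traceForm P S₀ S₂ + traceForm P S₂ S₀) +
      Real.cos (2 * x) ^ 2 * traceForm P S₁ S₁ + Real.sin (2 * x) ^ 2 * traceForm P S₂ S₂ +
      Real.cos (2 * x) * Real.sin (2 * x) * (traceForm P S₁ S₂ + traceForm P S₂ S₁) := by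
    intro x
    rw [hσ]
    simp only [traceForm_add_left, traceForm_add_right, traceForm_smul_left, traceForm_smul_right]
    ring
  have hcp : Real.cos (2 * (x + Real.pi / 4)) = -Real.sin (2 * x) := by
    rw [show 2 * (x + Real.pi / 4) = 2 * x + Real.pi / 2 by ring, Real.cos_add_pi_div_two]
  have hsp : Real.sin (2 * (x + Real.pi / 4)) = Real.cos (2 * x) := by
    rw [show 2 * (x + Real.pi / 4) = 2 * x + Real.pi / 2 by ring, Real.sin_add_pi_div_two]
  have hcm : Real.cos (2 * (x - Real.pi / 4)) = Real.sin (2 * x) := by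
    rw [show 2 * (x - Real.pi / 4) = 2 * x - Real.pi / 2 by ring, Real.cos_sub_pi_div_two]
  have hsm : Real.sin (2 * (x - Real.pi / 4)) = -Real.cos (2 * x) := by
    rw [show 2 * (x - Real.pi / 4) = 2 * x - Real.pi / 2 by ring, Real.sin_sub_pi_div_two]
  have hc8p : Real.cos (2 * (x + Real.pi / 8)) =
      √2 / 2 * (Real.cos (2 * x) - Real.sin (2 * x)) := by
    rw [show 2 * (x + Real.pi / 8) = 2 * x + Real.pi / 4 by ring, Real.cos_add,
      Real.cos_pi_div_four, Real.sin_pi_div_four]; ring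
  have hs8p : Real.sin (2 * (x + Real.pi / 8)) =
      √2 / 2 * (Real.sin (2 * x) + Real.cos (2 * x)) := by
    rw [show 2 * (x + Real.pi / 8) = 2 * x + Real.pi / 4 by ring, Real.sin_add,
      Real.cos_pi_div_four, Real.sin_pi_div_four]; ring
  have hc8m : Real.cos (2 * (x - Real.pi / 8)) =
      √2 / 2 * (Real.cos (2 * x) + Real.sin (2 * x)) := by
    rw [show 2 * (x - Real.pi / 8) = 2 * x - Real.pi / 4 by ring, Real.cos_sub,
      Real.cos_pi_div_four, Real.sin_pi_div_four]; ring
  have hs8m : Real.sin (2 * (x - Real.pi / 8)) =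
      √2 / 2 * (Real.sin (2 * x) - Real.cos (2 * x)) := by
    rw [show 2 * (x - Real.pi / 8) = 2 * x - Real.pi / 4 by ring, Real.sin_sub,
      Real.cos_pi_div_four, Real.sin_pi_div_four]; ring
  -- This difference is the derivative of σ at x, so the first formula for A is the product rule.
  have hσ' : σ (x + Real.pi / 4) - σ (x - Real.pi / 4) =
      ((-2 * Real.sin (2 * x) : ℝ) : ℂ) • S₁ + ((2 * Real.cos (2 * x) : ℝ) : ℂ) • S₂ := by
    rw [hσ, hσ, hcp, hsp, hcm, hsm]
    push_cast
    module
  have h2 : √2 ^ 2 = 2 := Real.sq_sqrt (by norm_num)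
  have hlin : HasDerivAt (fun x : ℝ => 2 * x) 2 x := by
    simpa using (hasDerivAt_id x).const_mul (2 : ℝ)
  have hc : HasDerivAt (fun x : ℝ => Real.cos (2 * x)) (-Real.sin (2 * x) * 2) x := hlin.cos
  have hs : HasDerivAt (fun x : ℝ => Real.sin (2 * x)) (Real.cos (2 * x) * 2) x := hlin.sin
  have hd := (((((hasDerivAt_const x (traceForm P S₀ S₀)).add
    (hc.mul_const (traceForm P S₀ S₁ + traceForm P S₁ S₀))).add
    (hs.mul_const (traceForm P S₀ S₂ + traceForm P S₂ S₀))).add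
    ((hc.pow 2).mul_const (traceForm P S₁ S₁))).add
    ((hs.pow 2).mul_const (traceForm P S₂ S₂))).add
    ((hc.mul hs).mul_const (traceForm P S₁ S₂ + traceForm P S₂ S₁))
  refine ⟨_, ?_, rfl, ?_⟩
  · refine (hd.congr_of_eventuallyEq (Filter.Eventually.of_forall fun x => ?_)).congr_deriv ?_
    · rw [hB]; rfl
    · rw [hσ', hσ]
      simp only [traceForm_add_left, traceForm_add_right, traceForm_smul_left,
        traceForm_smul_right]
      push_cast
      ring
  -- On frequency 2 the shifts ±π/4 give the derivative and ±π/8 give √2/2 of it, and (1 − √2) + 2 ·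
  -- √2/2 = 1. On frequency 4 the shifts ±π/4 give 0 and ±π/8 half the derivative. Constants cancel.
  · rw [hσ', hσ x, hB (x + Real.pi / 4), hB (x - Real.pi / 4), hB (x + Real.pi / 8),
      hB (x - Real.pi / 8), hcp, hsp, hcm, hsm, hc8p, hs8p, hc8m, hs8m]
    simp only [traceForm_add_left, traceForm_add_right, traceForm_smul_left,
      traceForm_smul_right]
    ring_nf
    simp only [h2]
    ring

/-! ### Scalar bounds and propagation of errors -/

theorem posDef_trace_inv {R : Type} [Fintype R] [DecidableEq R] {ρ : Op R} (hρ : ρ.PosDef) :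
    ∃ τ : ℝ, 0 < τ ∧ ρ⁻¹.trace = τ := by
  have h := hρ.inv.trace_pos
  obtain ⟨h1, h2⟩ := Complex.lt_def.1 h
  exact ⟨ρ⁻¹.trace.re, h1, Complex.ext rfl (by simpa using h2.symm)⟩

/-- The sandwiched quantity `Tr(σ² ρ⁻¹)` is at least one for normalized states. -/
theorem one_le_trace_sq_mul_inv {R : Type} [Fintype R] [DecidableEq R] {ρ σ : Op R}
    (hρ : IsInvertibleState ρ) (hσ : σ.IsHermitian) (hσ1 : σ.trace = 1) :
    1 ≤ (σ ^ 2 * ρ⁻¹).trace.re := by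
  have hdet : IsUnit ρ.det := (Matrix.isUnit_iff_isUnit_det _).1 hρ.1.isUnit
  -- Expanding 0 ≤ Tr((σ − ρ)² ρ⁻¹) with both traces equal to one gives the claim.
  have h := traceForm_self_nonneg hρ.1.inv.posSemidef (hσ.sub hρ.1.isHermitian)
  have hexp : ((σ - ρ) * (σ - ρ) * ρ⁻¹).trace = (σ ^ 2 * ρ⁻¹).trace - 1 := by
    have h1 : (σ * ρ) * ρ⁻¹ = σ := Matrix.mul_nonsing_inv_cancel_right _ _ hdet
    have h2 : (ρ * ρ) * ρ⁻¹ = ρ := Matrix.mul_nonsing_inv_cancel_right _ _ hdet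
    have h3 : ((ρ * σ) * ρ⁻¹).trace = 1 := by
      rw [mul_assoc, Matrix.trace_mul_comm, Matrix.nonsing_inv_mul_cancel_right _ _ hdet, hσ1]
    simp only [sub_mul, mul_sub, Matrix.trace_sub, h1, h2, h3, hσ1, hρ.2, pow_two]
    ring
  rw [traceForm, hexp] at h
  simpa using h

theorem abs_sq_sub_le {r B δ : ℝ} (hB0 : 0 ≤ B) (hB1 : B ≤ 1) (h : |r - √B| ≤ δ)
    (hδ : δ ≤ 1 / 100) : |r ^ 2 - B| ≤ 201 / 100 * δ := by
  have hb : √B ≤ 1 := Real.sqrt_le_one.2 hB1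
  have hb0 := Real.sqrt_nonneg B
  have hsq := Real.sq_sqrt hB0
  rw [show r ^ 2 - B = (r - √B) * (r + √B) by
    linear_combination hsq, abs_mul]
  have h2 : |r + √B| ≤ 201 / 100 := by
    rw [abs_le] at *
    constructor <;> linarith
  have := abs_nonneg (r - √B)
  nlinarith [abs_nonneg (r + √B)]

/-- Propagation of the errors to the quotient. -/
theorem abs_quotient_sub_le {A A' B r δ ε : ℝ} (hB0 : 0 < B) (hB1 : B ≤ 1) (hε : ε ≤ 13 / 2)
    (hδ : δ ≤ ε * B / 1000) (hA : A ^ 2 ≤ 16 * B) (hA' : |A' - A| ≤ 11 * δ)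
    (hr : |r - √B| ≤ δ) : |A' / r ^ 2 - A / B| ≤ ε := by
  set b := √B with hbdef
  have hb : 0 < b := Real.sqrt_pos.2 hB0
  have hbB : b ^ 2 = B := Real.sq_sqrt hB0.le
  have hb1 : b ≤ 1 := Real.sqrt_le_one.2 hB1
  have hδ0 : 0 ≤ δ := (abs_nonneg _).trans hr
  -- δ ≤ εb²/1000 with ε ≤ 13/2 and b ≤ 1: the relative error of `r` is below one percent.
  have hδb : δ ≤ b / 100 := by rw [← hbB] at hδ; nlinarith
  obtain ⟨hr1, hr2⟩ := abs_le.1 hr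
  have hrlow : 99 / 100 * b ≤ r := by linarith
  have hr2low : 98 / 100 * B ≤ r ^ 2 := by rw [← hbB]; nlinarith
  have hA4 : |A| ≤ 4 * b := by
    refine abs_le_of_sq_le_sq ?_ (by positivity)
    rw [mul_pow, hbB]; linarith
  have hrB : |B - r ^ 2| ≤ 201 / 100 * b * δ := by
    rw [← hbB, show b ^ 2 - r ^ 2 = -(r - b) * (r + b) by ring, abs_mul, abs_neg]
    have : |r + b| ≤ 201 / 100 * b := by
      rw [abs_le]; constructor <;> linarith
    nlinarith [abs_nonneg (r - b), abs_nonneg (r + b)]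
  have hrpos : 0 < r ^ 2 := by nlinarith
  -- The factor √B in the error of r² meets |A| ≤ 4√B, so both terms are of order δB and no extra
  -- power B^(−1/2) is lost. The constants are 11 + 8.04 ≤ 20.
  have hnum : |A' * B - r ^ 2 * A| ≤ 20 * δ * B := by
    rw [show A' * B - r ^ 2 * A = (A' - A) * B + A * (B - r ^ 2) by ring]
    refine (abs_add_le _ _).trans ?_
    rw [abs_mul, abs_mul, abs_of_pos hB0]
    have h1 : |A' - A| * B ≤ 11 * δ * B := by gcongr
    have h2 : |A| * |B - r ^ 2| ≤ (4 * b) * (201 / 100 * b * δ) := by gcongr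
    have h3 : (4 * b) * (201 / 100 * b * δ) = 804 / 100 * δ * B := by rw [← hbB]; ring
    nlinarith [mul_nonneg hδ0 hB0.le]
  rw [div_sub_div _ _ hrpos.ne' hB0.ne', abs_div, abs_of_pos (mul_pos hrpos hB0),
    div_le_iff₀ (mul_pos hrpos hB0)]
  have hεB : 0 ≤ ε * B := by linarith
  have hε0 : 0 ≤ ε := nonneg_of_mul_nonneg_left hεB hB0
  calc _ ≤ 20 * δ * B := hnum
    _ ≤ 20 * (ε * B / 1000) * B := by gcongr
    _ ≤ ε * (98 / 100 * B * B) := by nlinarith [mul_nonneg hεB hB0.le]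
    _ ≤ ε * (r ^ 2 * B) := by gcongr

/-! ### The derivative of the divergence from five estimates -/

section Gradient

variable {nv nh a N : ℕ}

theorem mul_self_eq_one {R : Type} [Fintype R] [DecidableEq R] {N : ℕ} {H : Fin N → Op R}
    (hH : ∀ j, (H j).IsHermitian ∧ H j ∈ Matrix.unitaryGroup (Bits R) ℂ) (j : Fin N) :
    H j * H j = 1 := by
  have := Matrix.mem_unitaryGroup_iff.1 (hH j).2
  rwa [star_eq_conjTranspose, (hH j).1] at this

/-- The shifts of the parameter-shift rule. -/
def shift : Fin 5 → ℝ := ![0, Real.pi / 4, -(Real.pi / 4), Real.pi / 8, -(Real.pi / 8)]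

/-- The logarithmic derivative by the parameter-shift rule, from square roots of the values. -/
def shiftQuotient (r : Fin 5 → ℝ) : ℝ :=
  ((1 - √2) * (r 1 ^ 2 - r 2 ^ 2) + 2 * (r 3 ^ 2 - r 4 ^ 2)) / r 0 ^ 2

/-- If the five values are estimated well enough, then so is the derivative of the divergence. -/
theorem exists_hasDerivAt_maxRenyi2 {ρ : Op (Fin nv)} (hρ : IsInvertibleState ρ)
    {H : Fin N → Op (Fin nv ⊕ Fin nh)}
    (hH : ∀ j, (H j).IsHermitian ∧ H j ∈ Matrix.unitaryGroup (Bits (Fin nv ⊕ Fin nh)) ℂ)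
    (k : Fin N) (θ : Fin N → ℝ) {ε p : ℝ} (hp : 0 < p)
    (hB : ∀ θ', (visibleState H θ' ^ 2 * normalizedInverse ρ).trace.re ≤ 1)
    (hpB : p ≤ (visibleState H θ ^ 2 * normalizedInverse ρ).trace.re)
    (hεT : ε ≤ 13 / (2 * (visibleState H θ ^ 2 * ρ⁻¹).trace.re)) :
    ε ≤ 13 / 2 ∧ p ≤ 1 ∧ ∃ g : ℝ,
      HasDerivAt (fun x => maxRenyi2 (visibleState H (Function.update θ k x)) ρ) g (θ k) ∧
      ∀ (δ : ℝ) (r : Fin 5 → ℝ), 0 ≤ ε → δ ≤ ε * p / 1000 →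
        (∀ i, |r i - √(visibleState H (Function.update θ k (θ k + shift i)) ^ 2 *
          normalizedInverse ρ).trace.re| ≤ δ) →
        |shiftQuotient r - g| ≤ ε := by
  have hHH := mul_self_eq_one hH
  obtain ⟨τ, hτ, hτeq⟩ := posDef_trace_inv hρ.1
  set P := normalizedInverse ρ with hPdef
  have hP : P.PosSemidef := by
    rw [hPdef, normalizedInverse, hτeq, ← Complex.ofReal_inv]
    exact hρ.1.inv.posSemidef.smul (Complex.zero_le_real.2 (inv_nonneg.2 hτ.le))
  have hscale : ∀ X : Op (Fin nv), (X ^ 2 * ρ⁻¹).trace.re = τ * traceForm P X X := by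
    intro X
    rw [traceForm, hPdef, normalizedInverse, hτeq, mul_smul_comm, Matrix.trace_smul, smul_eq_mul,
      ← Complex.ofReal_inv, Complex.re_ofReal_mul, ← mul_assoc, mul_inv_cancel₀ hτ.ne', one_mul,
      pow_two]
  have hform : ∀ X : Op (Fin nv), (X ^ 2 * P).trace.re = traceForm P X X := fun X => by
    rw [traceForm, pow_two]
  simp only [hform] at hB hpB ⊢
  have hT1 := one_le_trace_sq_mul_inv hρ (visibleState_isHermitian (H := H) θ)
    (trace_visibleState hHH (fun j => (hH j).1) θ)
  have hε2 : ε ≤ 13 / 2 := by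
    refine hεT.trans ?_
    gcongr
    linarith
  obtain ⟨S₀, S₁, S₂, hσ⟩ := exists_visibleState_trig hHH θ k
  set σ : ℝ → Op (Fin nv) := fun x => visibleState H (Function.update θ k x) with hσdef
  obtain ⟨A, hderiv, hA1, hA2⟩ := hasDerivAt_traceForm P S₀ S₁ S₂ σ hσ (θ k)
  have hσθ : σ (θ k) = visibleState H θ := by
    rw [hσdef]; simp
  have hherm : ∀ x, (σ x).IsHermitian := fun x => visibleState_isHermitian _
  have hσ1 : ∀ x, traceForm P (σ x) (σ x) ≤ 1 := fun x => hB _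
  have hσ0 : ∀ x, 0 ≤ traceForm P (σ x) (σ x) := fun x => traceForm_self_nonneg hP (hherm x)
  rw [← hσθ] at hpB
  have hBpos : 0 < traceForm P (σ (θ k)) (σ (θ k)) := hp.trans_le hpB
  -- A is the symmetrised form of σ and its derivative σ₊ − σ₋. Cauchy-Schwarz bounds A² by 4B times
  -- the form at σ₊ − σ₋, and the parallelogram law bounds the latter by 2 + 2.
  have hAsq : A ^ 2 ≤ 16 * traceForm P (σ (θ k)) (σ (θ k)) := by
    have hd := (hherm (θ k + Real.pi / 4)).sub (hherm (θ k - Real.pi / 4))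
    have h1 := traceForm_sq_le hP (hherm (θ k)) hd
    rw [← hA1] at h1
    have h2 := traceForm_self_nonneg hP
      ((hherm (θ k + Real.pi / 4)).add (hherm (θ k - Real.pi / 4)))
    have h3 : ∀ X Y : Op (Fin nv), traceForm P (X - Y) (X - Y) + traceForm P (X + Y) (X + Y) =
        2 * traceForm P X X + 2 * traceForm P Y Y := fun X Y => by
      simp only [traceForm, add_mul, sub_mul, mul_add, mul_sub, Matrix.trace_add,
        Matrix.trace_sub, Complex.add_re, Complex.sub_re]
      ring
    have h4 := h3 (σ (θ k + Real.pi / 4)) (σ (θ k - Real.pi / 4))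
    have h5 := hσ1 (θ k + Real.pi / 4)
    have h6 := hσ1 (θ k - Real.pi / 4)
    nlinarith
  refine ⟨hε2, hpB.trans (hσ1 _), A / traceForm P (σ (θ k)) (σ (θ k)), ?_, ?_⟩
  -- The factor τ = Tr(ρ⁻¹) is constant in x and cancels from the logarithmic derivative.
  · have h := (hderiv.const_mul τ).log (mul_pos hτ hBpos).ne'
    rw [mul_div_mul_left _ _ hτ.ne'] at h
    refine h.congr_of_eventuallyEq (Filter.Eventually.of_forall fun x => ?_)
    simp only [maxRenyi2, hscale]
    rfl
  · intro δ r hε0 hδ hr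
    have h0 := hr 0
    have h1 := hr 1
    have h2 := hr 2
    have h3 := hr 3
    have h4 := hr 4
    simp only [shift, Matrix.cons_val, add_zero, ← sub_eq_add_neg] at h0 h1 h2 h3 h4
    have hp1 : p ≤ 1 := hpB.trans (hσ1 _)
    have hδ2 : δ ≤ 1 / 100 := by nlinarith
    have e1 := abs_sq_sub_le (hσ0 _) (hσ1 _) h1 hδ2
    have e2 := abs_sq_sub_le (hσ0 _) (hσ1 _) h2 hδ2
    have e3 := abs_sq_sub_le (hσ0 _) (hσ1 _) h3 hδ2
    have e4 := abs_sq_sub_le (hσ0 _) (hσ1 _) h4 hδ2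
    refine abs_quotient_sub_le hBpos (hσ1 _) hε2 (hδ.trans ?_) hAsq ?_ h0
    · gcongr
    -- With √2 − 1 ≤ 1/2 the total error of the shift rule is at most (1 + 4) · 2.01 δ ≤ 11δ.
    · have hs1 : 1 ≤ √2 := Real.one_le_sqrt.2 (by norm_num)
      have hs2 : √2 ≤ 3 / 2 := by
        rw [Real.sqrt_le_left (by norm_num)]; norm_num
      have hδ0 : 0 ≤ δ := (abs_nonneg _).trans h0
      rw [hA2]
      rw [abs_le] at e1 e2 e3 e4 ⊢
      constructor <;> nlinarith

end Gradient

end QNN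

end

/-! ### Choice of the accuracy and assembly -/

theorem theorem4 :
    ∃ C : ℝ, 0 < C ∧
      ∀ (nv nh a N : ℕ) (k : Fin N) (θ : Fin N → ℝ) (ε p : ℝ), 0 < ε → 0 < p →
        ∃ (n : ℕ) (c : QNN.Circuit nv nh a N n) (estimate : QNN.Bits (Fin n) → ℝ),
          (c.cost : ℝ) ≤ C * (N + nv) / (ε * p) ∧
          (c.reflections : ℝ) ≤ C / (ε * p) ∧
          (c.reflectionSize : ℝ) ≤ C * (N + nv + nh + a) / (ε * p) ∧
          ∀ (ρ : QNN.Op (Fin nv)) (H : Fin N → QNN.Op (Fin nv ⊕ Fin nh))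
            (W : QNN.Op (Fin nv ⊕ Fin a)),
            QNN.IsInvertibleState ρ →
            (∀ j, (H j).IsHermitian ∧
              H j ∈ Matrix.unitaryGroup (QNN.Bits (Fin nv ⊕ Fin nh)) ℂ) →
            QNN.PreparesInverse W ρ →
            p ≤ (QNN.visibleState H θ ^ 2 * QNN.normalizedInverse ρ).trace.re →
            ε ≤ 13 / (2 * (QNN.visibleState H θ ^ 2 * ρ⁻¹).trace.re) →
            ∃ g : ℝ,
              HasDerivAt
                (fun x => QNN.maxRenyi2 (QNN.visibleState H (Function.update θ k x)) ρ)
                g (θ k) ∧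
              2 / 3 < c.prob W H {x | |estimate x - g| ≤ ε} := by
  -- The largest requirement is the gate count, 5 · 60000 · 4000 = 1.2 · 10⁹: five estimations, the
  -- cost of one, and 4^J ≤ 4000/(εp).
  refine ⟨2000000000, by norm_num, fun nv nh a N k θ ε p hε hp => ?_⟩
  have hN : 0 < N := k.pos
  have hεp : 0 < ε * p := mul_pos hε hp
  have hbound : ∀ (H : Fin N → QNN.Op (Fin nv ⊕ Fin nh)) (ρ : QNN.Op (Fin nv))
      (W : QNN.Op (Fin nv ⊕ Fin a)), (∀ j, (H j).IsHermitian ∧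
        H j ∈ Matrix.unitaryGroup (QNN.Bits (Fin nv ⊕ Fin nh)) ℂ) → QNN.PreparesInverse W ρ →
      ∀ θ', (QNN.visibleState H θ' ^ 2 * QNN.normalizedInverse ρ).trace.re ≤ 1 :=
    fun H ρ W hH hW θ' => by
      -- Only the bound by 1 is taken from here, so the accuracy level 0 is arbitrary.
      obtain ⟨_, _, _, _, _, _, h⟩ := QNN.exists_sqrt_estimation nv nh a N hN θ' 0
      exact (h ρ H W hH hW).2.1
  -- The hypotheses on an instance force p ≤ 1 and, since Tr(σ_v² ρ⁻¹) ≥ 1, also ε ≤ 13/2. Otherwise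
  -- no instance has to be served and the empty circuit suffices.
  by_cases hsmall : ε * p ≤ 13 / 2
  -- 4^j ≤ 1000/(εp) < 4^(j+1): level j + 1 reaches the accuracy εp/1000 and overshoots it by at
  -- most a factor 4.
  · obtain ⟨j, hj1, hj2⟩ := exists_nat_pow_near (x := 1000 / (ε * p)) (y := (4 : ℝ))
      (by rw [le_div_iff₀ hεp]; linarith) (by norm_num)
    obtain ⟨n, c, est, h1, h2, h3, h4⟩ := QNN.exists_sqrt_estimations nv nh a N hN (j + 1) 5
      (fun i => Function.update θ k (θ k + QNN.shift i))
    have hpow : (4 : ℝ) ^ (j + 1) ≤ 4000 / (ε * p) := by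
      rw [pow_succ, show (4000 : ℝ) / (ε * p) = 1000 / (ε * p) * 4 by ring]
      linarith
    refine ⟨n, c, fun x => QNN.shiftQuotient (est x), ?_, ?_, ?_,
      fun ρ H W hρ hH hW hpB hεT => ?_⟩
    · have h1' : (c.cost : ℝ) ≤ 5 * (60000 * 4 ^ (j + 1) * N) := by exact_mod_cast h1
      calc (c.cost : ℝ) ≤ 5 * (60000 * 4 ^ (j + 1) * N) := h1'
        _ ≤ 5 * (60000 * (4000 / (ε * p)) * N) := by gcongr
        _ = 1200000000 * N / (ε * p) := by ring
        _ ≤ 2000000000 * (N + nv) / (ε * p) := by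
          refine div_le_div_of_nonneg_right ?_ hεp.le
          nlinarith [Nat.cast_nonneg (α := ℝ) N, Nat.cast_nonneg (α := ℝ) nv]
    · have h2' : (c.reflections : ℝ) ≤ 5 * (8192 * 4 ^ (j + 1)) := by exact_mod_cast h2
      calc (c.reflections : ℝ) ≤ 5 * (8192 * 4 ^ (j + 1)) := h2'
        _ ≤ 5 * (8192 * (4000 / (ε * p))) := by gcongr
        _ = 163840000 / (ε * p) := by ring
        _ ≤ 2000000000 / (ε * p) := by gcongr; norm_num
    · have h3' : (c.reflectionSize : ℝ) ≤ 5 * (8192 * 4 ^ (j + 1) * (2 * nv + nh + a + 1)) := by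
        exact_mod_cast h3
      have hN1 : (1 : ℝ) ≤ N := by exact_mod_cast hN
      calc (c.reflectionSize : ℝ) ≤ 5 * (8192 * 4 ^ (j + 1) * (2 * nv + nh + a + 1)) := h3'
        _ ≤ 5 * (8192 * (4000 / (ε * p)) * (2 * nv + nh + a + 1)) := by gcongr
        _ = 163840000 * (2 * nv + nh + a + 1) / (ε * p) := by ring
        _ ≤ 2000000000 * (N + nv + nh + a) / (ε * p) := by
          refine div_le_div_of_nonneg_right ?_ hεp.le
          nlinarith [Nat.cast_nonneg (α := ℝ) nh, Nat.cast_nonneg (α := ℝ) nv,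
            Nat.cast_nonneg (α := ℝ) a]
    · obtain ⟨-, -, g, hg, hest⟩ := QNN.exists_hasDerivAt_maxRenyi2 hρ hH k θ hp
        (hbound H ρ W hH hW) hpB hεT
      refine ⟨g, hg, ?_⟩
      calc (2 : ℝ) / 3 < (15 / 16) ^ 5 := by norm_num
        _ ≤ _ := h4 ρ H W hH hW
        _ ≤ _ := QNN.prob_mono W H c fun x hx => hest (1 / 4 ^ (j + 1)) (est x) hε.le ?_ hx
      rw [div_le_iff₀ (by positivity)]
      rw [div_lt_iff₀ hεp] at hj2
      linarith
  · refine ⟨0, [], fun _ => 0, ?_, ?_, ?_, fun ρ H W hρ hH hW hpB hεT => ?_⟩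
    · simp only [QNN.Circuit.cost, List.map_nil, List.sum_nil, Nat.cast_zero]; positivity
    · simp only [QNN.Circuit.reflections, List.map_nil, List.sum_nil, Nat.cast_zero]; positivity
    · simp only [QNN.Circuit.reflectionSize, List.map_nil, List.sum_nil, Nat.cast_zero]; positivity
    · obtain ⟨hε2, hp1, -⟩ := QNN.exists_hasDerivAt_maxRenyi2 hρ hH k θ hp
        (hbound H ρ W hH hW) hpB hεT
      exact absurd (by nlinarith) hsmall
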